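/- Let $X=(X_t)_{t\ge 0}$ be a subordinator (a Lévy process with nondecreasing paths) with drift $d\ge 0$ and Lévy measure $\nu$ on $(0,\infty)$, $\int_0^\infty (z\wedge 1)\,\nu(dz)<\infty$, i.e. $\phi(u):=\mathsf E e^{-uX_1}=\exp\big(-du+\int_0^\infty(e^{-uz}-1)\,\nu(dz)\big)$ for $u\ge 0$. Let $n>0$ be real, and let $X^{(n)},Y^{(n)},Z^{(n)}$ be regulated $X$-clocks of degree $n$ of types I, II, III, i.e. subordinators of the following kind. For integer $n$ they are induced by averaging. With $\bar X^{(0)}=X$ and $\bar X^{(k)}_t=\frac1t\int_0^t\bar X^{(k-1)}_s\,ds$, one has $X^{(n)}_t\overset{d}{=}\bar X^{(n)}_t$ for all $t$. With $Y^{(0)}=X$, each $Y^{(k)}$ ($1\le k\le n$) is a subordinator with $Y^{(k)}_t\overset{d}{=}\frac1t\int_0^tY^{(k-1)}_s\,ds$ for all $t$. Finally $Z^{(n)}_t\overset{d}{=}t^{-n}\int_0^t\int_0^{s_n}\cdots\int_0^{s_2}X_{s_1}\,ds_1\cdots ds_n$ for all $t$. (All averages are $0$ at $t=0$.) For real $n>0$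 they are given by their Laplace transforms: for all $t,u\ge 0$, $$\mathsf E e^{-uX^{(n)}_t}=\exp\Big(t\int_0^1\log\phi\Big(\Big(1-\frac{\Gamma(n,-\log s)}{\Gamma(n)}\Big)u\Big)ds\Big),$$ $$\mathsf E e^{-uY^{(n)}_t}=\exp\Big(\frac{t}{\Gamma(n)}\int_0^1(-\log v)^{n-1}\log\phi(uv)\,dv\Big),$$ $$\mathsf E e^{-uZ^{(n)}_t}=\exp\Big(t\int_0^1\log\phi\Big(\frac{s^nu}{\Gamma(n+1)}\Big)ds\Big),$$ where $\Gamma(n,x)=\int_x^\infty y^{n-1}e^{-y}\,dy$. At integer $n$ the result below holds for clocks given in either way. Let $\mu\in\mathbb R$ and $\kappa_1,\kappa_2\ge 0$, not both zero. For a clock $W\in\{X,X^{(n)},Y^{(n)},Z^{(n)}\}$ let $W'$ be an independent copy of $W$, and define the constant mixture $\xi^W_t=\mu t+\kappa_1W_t-\kappa_2W'_t$; write $\xi^X$, $\xi^{(n),X}$, $\xi^{(n),Y}$, $\xi^{(n),Z}$ for the mixtures based on $X,X^{(n)},Y^{(n)},Z^{(n)}$. For a real-valued process $V$ with Lévy measure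 $\nu_V$ (given by the Lévy–Khintchine representation of the characteristic functions of the $V_t$) let $\mathfrak B(V)=\inf\{p>0:\int_{|z|\le 1}|z|^p\,\nu_V(dz)<\infty\}$ be its Blumenthal–Getoor index. Then $X$ and the four mixtures have Lévy measures, and $$\mathfrak B(\xi^{(n),X})=\mathfrak B(\xi^{(n),Y})=\mathfrak B(\xi^{(n),Z})=\mathfrak B(\xi^{X})=\mathfrak B(X).$$ -/

import Mathlib

open MeasureTheory ProbabilityTheory Filter Topology
open scoped NNReal ENNReal

namespace RegulatedClock

noncomputable section

universe u

variable {Ω : Type u} [MeasurableSpace Ω]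

/-! ### Lévy processes and subordinators -/

/-- A real-valued Lévy process `(X_t)_{t ≥ 0}`: it starts at `0`, has independent and stationary
increments, and its paths are almost surely right-continuous with left limits. -/
structure IsLevyProcess (P : Measure Ω) (X : ℝ≥0 → Ω → ℝ) : Prop where
  measurable : ∀ t, Measurable (X t)
  zero : ∀ᵐ ω ∂P, X 0 ω = 0
  indep : HasIndepIncrements X P
  stationary : ∀ s t, IdentDistrib (fun ω => X (s + t) ω - X s ω) (X t) P P
  cadlag : ∀ᵐ ω ∂P, ∀ t, ContinuousWithinAt (fun s => X s ω) (Set.Ici t) t ∧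
    ∃ l : ℝ, Tendsto (fun s => X s ω) (𝓝[<] t) (𝓝 l)

/-- A subordinator (stochastic clock): a Lévy process with almost surely nondecreasing paths. -/
structure IsSubordinator (P : Measure Ω) (X : ℝ≥0 → Ω → ℝ) : Prop where
  levy : IsLevyProcess P X
  mono : ∀ᵐ ω ∂P, Monotone (fun t => X t ω)

/-- The Laplace transform `u ↦ E e^{-uV}` of a (nonnegative) random variable. -/
def laplace (P : Measure Ω) (V : Ω → ℝ) (u : ℝ) : ℝ := ∫ ω, Real.exp (-(u * V ω)) ∂P

/-- The subordinator `X` has drift `d ≥ 0` and Lévy measure `ν` on `(0, ∞)`: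
`E e^{-u X_1} = exp (-d u + ∫ (e^{-uz} - 1) ν(dz))` for `u ≥ 0`, with `∫ (z ∧ 1) ν(dz) < ∞`. -/
structure HasDriftAndLevyMeasure (P : Measure Ω) (X : ℝ≥0 → Ω → ℝ) (d : ℝ) (ν : Measure ℝ) :
    Prop where
  drift_nonneg : 0 ≤ d
  support : ν (Set.Iic 0) = 0
  finite : ∫⁻ z, ENNReal.ofReal (min z 1) ∂ν < ∞
  laplace_eq : ∀ u : ℝ, 0 ≤ u →
    laplace P (X 1) u = Real.exp (-(d * u) + ∫ z, (Real.exp (-(u * z)) - 1) ∂ν)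

/-! ### Lévy measure and Blumenthal–Getoor index of a real-valued Lévy process -/

/-- A Lévy measure on the real line. -/
structure IsLevyMeasure (ν : Measure ℝ) : Prop where
  zero : ν {0} = 0
  finite : ∫⁻ z, ENNReal.ofReal (min (z ^ 2) 1) ∂ν < ∞

/-- The characteristic exponent of the Lévy–Khintchine triplet `(b, c, ν)`,
`i b u - c u² / 2 + ∫ (e^{iuz} - 1 - i u z 1_{|z| ≤ 1}) ν(dz)`. -/
def charExponent (b c : ℝ) (ν : Measure ℝ) (u : ℝ) : ℂ :=
  Complex.I * b * u - c * u ^ 2 / 2 +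
    ∫ z : ℝ, (Complex.exp (Complex.I * u * z) - 1 -
      Complex.I * u * (Set.Icc (-1 : ℝ) 1).indicator (fun y => y) z) ∂ν

/-- `ν` is the Lévy measure of the process `Z`: for some `b` and some `c ≥ 0` the characteristic
function of `Z_t` is `exp (t ψ)`, where `ψ` is the exponent of the triplet `(b, c, ν)`. -/
def HasLevyMeasure (P : Measure Ω) (Z : ℝ≥0 → Ω → ℝ) (ν : Measure ℝ) : Prop :=
  IsLevyMeasure ν ∧ ∃ b c : ℝ, 0 ≤ c ∧ ∀ (t : ℝ≥0) (u : ℝ),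
    ∫ ω, Complex.exp (Complex.I * u * Z t ω) ∂P =
      Complex.exp ((t : ℝ) * charExponent b c ν u)

open Classical in
/-- The Lévy measure of a process. -/
def levyMeasure (P : Measure Ω) (Z : ℝ≥0 → Ω → ℝ) : Measure ℝ :=
  if h : ∃ ν, HasLevyMeasure P Z ν then h.choose else 0

/-- The Blumenthal–Getoor index `inf {p > 0 : ∫_{|z| ≤ 1} |z|^p ν(dz) < ∞}`, where `ν` is the
Lévy measure of the process. -/
def bgIndex (P : Measure Ω) (Z : ℝ≥0 → Ω → ℝ) : ℝ :=
  sInf {p : ℝ | 0 < p ∧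
    ∫⁻ z in Set.Icc (-1 : ℝ) 1, ENNReal.ofReal (|z| ^ p) ∂(levyMeasure P Z) < ∞}

/-! ### The three averaging recipes, for integer degrees -/

/-- The cumulation `t ↦ ∫_0^t X_s ds`. -/
def cumulation (X : ℝ≥0 → Ω → ℝ) : ℝ≥0 → Ω → ℝ :=
  fun t ω => ∫ s in (0 : ℝ)..t, X s.toNNReal ω

/-- The running average `(1/t) ∫_0^t X_s ds`, which is `0` at `t = 0`. -/
def runningAverage (X : ℝ≥0 → Ω → ℝ) : ℝ≥0 → Ω → ℝ :=
  fun t ω => (t : ℝ)⁻¹ * cumulation X t ω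

/-- First recipe: the `k`-fold running average of the paths of `X`. -/
def averageI (X : ℝ≥0 → Ω → ℝ) (k : ℕ) : ℝ≥0 → Ω → ℝ := runningAverage^[k] X

/-- Third recipe: the `k`-fold cumulation of the paths of `X`, divided by `t ^ k`. -/
def averageIII (X : ℝ≥0 → Ω → ℝ) (k : ℕ) : ℝ≥0 → Ω → ℝ :=
  fun t ω => ((t : ℝ) ^ k)⁻¹ * (cumulation^[k] X) t ω

/-- `W` is induced by the first recipe of integer degree `k`: `W_t` has the law of the `k`-fold
running average, for every `t`. -/
def RecipeI (P : Measure Ω) (X : ℝ≥0 → Ω → ℝ) (k : ℕ) (W : ℝ≥0 → Ω → ℝ) : Prop :=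
  ∀ t, IdentDistrib (W t) (averageI X k t) P P

/-- `W` is induced by the second recipe of integer degree `k`: there are subordinators
`Y 0 = X, Y 1, …, Y k = W` such that `Y (j + 1)` has at every time the law of the running average
of `Y j`. -/
def RecipeII (P : Measure Ω) (X : ℝ≥0 → Ω → ℝ) (k : ℕ) (W : ℝ≥0 → Ω → ℝ) : Prop :=
  ∃ Y : ℕ → ℝ≥0 → Ω → ℝ, Y 0 = X ∧ Y k = W ∧ ∀ j < k, IsSubordinator P (Y (j + 1)) ∧
    ∀ t, IdentDistrib (Y (j + 1) t) (runningAverage (Y j) t) P P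

/-- `W` is induced by the third recipe of integer degree `k`. -/
def RecipeIII (P : Measure Ω) (X : ℝ≥0 → Ω → ℝ) (k : ℕ) (W : ℝ≥0 → Ω → ℝ) : Prop :=
  ∀ t, IdentDistrib (W t) (averageIII X k t) P P

/-! ### Regulated clocks of real degree `n > 0`

For an integer degree the clock is a subordinator induced by the averaging recipe. For a
fractional degree there is nothing to iterate, and the clock is a subordinator whose Laplace
transform is given by the formula below. The definitions accept either description, so that at
integer degrees no agreement between the two is presupposed. -/

/-- The upper incomplete gamma function `Γ(n, x) = ∫_x^∞ y^{n-1} e^{-y} dy`. -/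
def upperGamma (n x : ℝ) : ℝ := ∫ y in Set.Ioi x, y ^ (n - 1) * Real.exp (-y)

/-- `E e^{-u W_t} = exp (t ∫_0^1 log φ((1 - Γ(n, -log s) / Γ(n)) u) ds)` with `φ` the Laplace
transform of `X_1`. -/
def LaplaceI (P : Measure Ω) (X : ℝ≥0 → Ω → ℝ) (n : ℝ) (W : ℝ≥0 → Ω → ℝ) : Prop :=
  ∀ (t : ℝ≥0) (u : ℝ), 0 ≤ u → laplace P (W t) u =
    Real.exp (t * ∫ s in (0 : ℝ)..1,
      Real.log (laplace P (X 1) ((1 - upperGamma n (-Real.log s) / Real.Gamma n) * u)))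

/-- `E e^{-u W_t} = exp ((t / Γ(n)) ∫_0^1 (-log v)^{n-1} log φ(u v) dv)` with `φ` the Laplace
transform of `X_1`. -/
def LaplaceII (P : Measure Ω) (X : ℝ≥0 → Ω → ℝ) (n : ℝ) (W : ℝ≥0 → Ω → ℝ) : Prop :=
  ∀ (t : ℝ≥0) (u : ℝ), 0 ≤ u → laplace P (W t) u =
    Real.exp (t / Real.Gamma n * ∫ v in (0 : ℝ)..1,
      (-Real.log v) ^ (n - 1) * Real.log (laplace P (X 1) (u * v)))

/-- `E e^{-u W_t} = exp (t ∫_0^1 log φ(s^n u / Γ(n+1)) ds)` with `φ` the Laplace transform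
of `X_1`. -/
def LaplaceIII (P : Measure Ω) (X : ℝ≥0 → Ω → ℝ) (n : ℝ) (W : ℝ≥0 → Ω → ℝ) : Prop :=
  ∀ (t : ℝ≥0) (u : ℝ), 0 ≤ u → laplace P (W t) u =
    Real.exp (t * ∫ s in (0 : ℝ)..1,
      Real.log (laplace P (X 1) (s ^ n * u / Real.Gamma (n + 1))))

/-- `W` is a type-I regulated `X`-clock of degree `n`. -/
def IsTypeI (P : Measure Ω) (X : ℝ≥0 → Ω → ℝ) (n : ℝ) (W : ℝ≥0 → Ω → ℝ) : Prop :=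
  IsSubordinator P W ∧ ((∃ k : ℕ, n = k ∧ RecipeI P X k W) ∨ LaplaceI P X n W)

/-- `W` is a type-II regulated `X`-clock of degree `n`. -/
def IsTypeII (P : Measure Ω) (X : ℝ≥0 → Ω → ℝ) (n : ℝ) (W : ℝ≥0 → Ω → ℝ) : Prop :=
  IsSubordinator P W ∧ ((∃ k : ℕ, n = k ∧ RecipeII P X k W) ∨ LaplaceII P X n W)

/-- `W` is a type-III regulated `X`-clock of degree `n`. -/
def IsTypeIII (P : Measure Ω) (X : ℝ≥0 → Ω → ℝ) (n : ℝ) (W : ℝ≥0 → Ω → ℝ) : Prop :=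
  IsSubordinator P W ∧ ((∃ k : ℕ, n = k ∧ RecipeIII P X k W) ∨ LaplaceIII P X n W)

/-! ### Constant mixtures -/

/-- `X'` is an independent copy of the process `X`. -/
def IsIndepCopy (P : Measure Ω) (X X' : ℝ≥0 → Ω → ℝ) : Prop :=
  IdentDistrib (fun ω t => X' t ω) (fun ω t => X t ω) P P ∧
    IndepFun (fun ω t => X t ω) (fun ω t => X' t ω) P

/-- The constant mixture `μ t + κ₁ X_t - κ₂ X'_t`. -/
def constantMixture (m κ₁ κ₂ : ℝ) (X X' : ℝ≥0 → Ω → ℝ) : ℝ≥0 → Ω → ℝ :=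
  fun t ω => m * t + κ₁ * X t ω - κ₂ * X' t ω

end

end RegulatedClock

namespace RegulatedClock

noncomputable section

/-! ### The Lévy measure is determined by the process near the origin -/

/-! Every clock and every mixture arises from `X` by rescaling jumps. The Laplace exponent of a
regulated clock `W` at time one is an average `∫ log φ(a u) η(da)` of that of `X`, where `η` is a
finite measure on bounded factors `a ≥ 0`, not concentrated at `0`. Hence the Lévy measure of `W` is
the image of `η ⊗ ν` under multiplication, `scaleMeasure η ν`. A constant mixture is the same
operation with `η = δ_{κ₁} + δ_{-κ₂}`. Such a rescaling does not change which powers `|z|^p` are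
integrable near the origin (`IsClockMeasure.bgSet_scaleMeasure`): a nonzero factor changes `|z|^p`
by a constant, and jumps that enter or leave `[-1, 1]` are controlled by `∫ (|z| ∧ 1) ν(dz) < ∞`.
For clocks given by a Laplace transform, `η` is read off the formula. For iterated averages, the
clock has at time one the law of `∫ X_s θ(ds)` for a kernel `θ` on `(0, 1]`. Summation by parts on a
grid and independence of increments give the exponent `∫_0^1 log φ(θ[r, ∞) u) dr`
(`IsSubordinator.laplace_integral_path`), so the factors are the tails of `θ`. Two analytic points
complete the argument. The index is defined through characteristic functions, so the Laplace
transform is continued analytically to the left half-plane and then taken to the imaginary axis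
(`IsSubordinator.integral_cexp`). It also uses an arbitrarily chosen Lévy measure, so uniqueness
near the origin is needed (`HasLevyMeasure.bgIndex_eq`): a second difference of the exponent is the
characteristic function of the finite measure `(2 - 2 cos z) ν(dz) + c δ_0`, and finite measures are
determined by their characteristic functions. -/

lemma integrable_of_norm_le_const_mul {ν : Measure ℝ} {g : ℝ → ℝ} (hgm : Measurable g)
    (hg0 : ∀ z, 0 ≤ g z) (hg : ∫⁻ z, ENNReal.ofReal (g z) ∂ν < ∞) {E : Type*}
    [NormedAddCommGroup E] {f : ℝ → E} (hf : AEStronglyMeasurable f ν) {C : ℝ}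
    (hC : ∀ᵐ z ∂ν, ‖f z‖ ≤ C * g z) : Integrable f ν := by
  have hgi : Integrable g ν :=
    (lintegral_ofReal_ne_top_iff_integrable hgm.aestronglyMeasurable (ae_of_all _ hg0)).1 hg.ne
  exact (hgi.const_mul C).mono' hf hC

/-- The compensated integrand of the Lévy–Khintchine formula. -/
def levyIntegrand (u z : ℝ) : ℂ :=
  Complex.exp (Complex.I * u * z) - 1 -
    Complex.I * u * (Set.Icc (-1 : ℝ) 1).indicator (fun y => y) z

lemma measurable_indicator_Icc :
    Measurable (fun z : ℝ => (((Set.Icc (-1 : ℝ) 1).indicator (fun y => y) z : ℝ) : ℂ)) :=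
  Complex.measurable_ofReal.comp (measurable_id.indicator measurableSet_Icc)

lemma measurable_levyIntegrand (u : ℝ) : Measurable (levyIntegrand u) := by
  unfold levyIntegrand
  exact ((by fun_prop : Measurable fun z : ℝ => Complex.exp (Complex.I * u * z) - 1)).sub
    (measurable_indicator_Icc.const_mul _)

lemma norm_exp_I_mul_mul (u z : ℝ) : ‖Complex.exp (Complex.I * u * z)‖ = 1 := by
  rw [mul_assoc, ← Complex.ofReal_mul, Complex.norm_exp_I_mul_ofReal]

/-- For `|z| ≤ 1` the Taylor remainder gives `(uz)^2` when `|uz| ≤ 1`, and otherwise `2 + |uz| ≤ 3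
(uz)^2`. For `|z| > 1` the compensator is absent and the integrand is at most `2`. -/
lemma norm_levyIntegrand_le (u z : ℝ) :
    ‖levyIntegrand u z‖ ≤ (3 * u ^ 2 + 2) * min (z ^ 2) 1 := by
  unfold levyIntegrand
  by_cases hz : z ∈ Set.Icc (-1 : ℝ) 1
  · rw [Set.indicator_of_mem hz]
    have hz1 : z ^ 2 ≤ 1 := by
      have := abs_le.2 ⟨hz.1, hz.2⟩
      nlinarith [abs_nonneg z, sq_abs z]
    rw [min_eq_left hz1]
    have hn : ‖Complex.I * (u : ℂ) * (z : ℂ)‖ = |u * z| := by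
      simp [abs_mul]
    have hsq : |u * z| ^ 2 = u ^ 2 * z ^ 2 := by rw [sq_abs]; ring
    rcases le_or_gt (|u * z|) 1 with h | h
    · have := Complex.norm_exp_sub_one_sub_id_le (x := Complex.I * u * z) (by rw [hn]; exact h)
      rw [hn, hsq] at this
      nlinarith [sq_nonneg u, sq_nonneg z, mul_nonneg (sq_nonneg u) (sq_nonneg z)]
    · have h1 : ‖Complex.exp (Complex.I * u * z) - 1 - Complex.I * u * z‖ ≤ 1 + 1 + |u * z| := by
        refine (norm_sub_le _ _).trans ?_
        rw [hn]
        gcongr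
        refine (norm_sub_le _ _).trans ?_
        rw [norm_exp_I_mul_mul]; simp
      nlinarith [sq_nonneg u, sq_nonneg z, mul_nonneg (sq_nonneg u) (sq_nonneg z)]
  · rw [Set.indicator_of_notMem hz]
    have hz1 : 1 ≤ z ^ 2 := by
      by_contra! h
      apply hz
      constructor <;> nlinarith
    rw [min_eq_right hz1]
    have : ‖Complex.exp (Complex.I * u * z) - 1‖ ≤ 1 + 1 := by
      refine (norm_sub_le _ _).trans ?_
      rw [norm_exp_I_mul_mul]; simp
    simp only [Complex.ofReal_zero, mul_zero, sub_zero, mul_one]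
    nlinarith [sq_nonneg u]

lemma measurable_min_sq : Measurable (fun z : ℝ => min (z ^ 2) 1) :=
  (measurable_id.pow_const 2).min measurable_const

lemma IsLevyMeasure.integrable_levyIntegrand {ν : Measure ℝ} (hν : IsLevyMeasure ν) (u : ℝ) :
    Integrable (levyIntegrand u) ν :=
  integrable_of_norm_le_const_mul measurable_min_sq (fun z => by positivity) hν.finite
    (measurable_levyIntegrand u).aestronglyMeasurable
    (ae_of_all _ fun z => norm_levyIntegrand_le u z)

lemma two_sub_two_cos_nonneg (z : ℝ) : 0 ≤ 2 - 2 * Real.cos z := by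
  linarith [Real.cos_le_one z]

/-- Constants and terms linear in `u` drop out of a second difference, and shifting `u` by `±1`
multiplies `e^{iuz}` by `e^{±iz}`. -/
lemma second_difference_levyIntegrand (u z : ℝ) :
    2 * levyIntegrand u z - levyIntegrand (u + 1) z - levyIntegrand (u - 1) z =
      (2 - 2 * Real.cos z : ℝ) • Complex.exp (u * z * Complex.I) := by
  unfold levyIntegrand
  have h1 : Complex.I * ((u + 1 : ℝ) : ℂ) * z = u * z * Complex.I + z * Complex.I := by
    push_cast; ring
  have h2 : Complex.I * ((u - 1 : ℝ) : ℂ) * z = u * z * Complex.I + -z * Complex.I := by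
    push_cast; ring
  have h3 : Complex.I * (u : ℂ) * z = u * z * Complex.I := by ring
  rw [h1, h2, h3, Complex.exp_add, Complex.exp_add, Complex.real_smul]
  push_cast
  rw [Complex.cos]
  ring

/-- The finite measure whose characteristic function is a second difference of the exponent of
the triplet `(b, c, ν)`. -/
def differenceMeasure (c : ℝ) (ν : Measure ℝ) : Measure ℝ :=
  ν.withDensity (fun z => ENNReal.ofReal (2 - 2 * Real.cos z)) +
    ENNReal.ofReal c • Measure.dirac 0

lemma IsLevyMeasure.integrable_two_sub_two_cos {ν : Measure ℝ} (hν : IsLevyMeasure ν) :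
    Integrable (fun z => 2 - 2 * Real.cos z) ν := by
  refine integrable_of_norm_le_const_mul measurable_min_sq (fun z => by positivity) hν.finite
    (by fun_prop) (C := 4) (ae_of_all _ fun z => ?_)
  rw [Real.norm_of_nonneg (two_sub_two_cos_nonneg z)]
  rcases le_total (z ^ 2) 1 with h | h
  · rw [min_eq_left h]
    nlinarith [Real.one_sub_sq_div_two_le_cos (x := z), sq_nonneg z]
  · rw [min_eq_right h]
    linarith [Real.neg_one_le_cos z]

lemma IsLevyMeasure.isFiniteMeasure_differenceMeasure {ν : Measure ℝ} (hν : IsLevyMeasure ν)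
    (c : ℝ) : IsFiniteMeasure (differenceMeasure c ν) := by
  have := isFiniteMeasure_withDensity_ofReal hν.integrable_two_sub_two_cos.2
  have : IsFiniteMeasure (ENNReal.ofReal c • (Measure.dirac 0 : Measure ℝ)) :=
    Measure.smul_finite _ ENNReal.ofReal_ne_top
  unfold differenceMeasure
  infer_instance

/-- The drift is linear in `u` and disappears. The quadratic Gaussian term leaves the constant `c`,
which is the characteristic function of the atom at `0`. -/
lemma IsLevyMeasure.charFun_differenceMeasure {ν : Measure ℝ} (hν : IsLevyMeasure ν)
    (b : ℝ) {c : ℝ} (hc : 0 ≤ c) (u : ℝ) :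
    charFun (differenceMeasure c ν) u =
      2 * charExponent b c ν u - charExponent b c ν (u + 1) - charExponent b c ν (u - 1) := by
  have hfin := isFiniteMeasure_withDensity_ofReal hν.integrable_two_sub_two_cos.2
  have hfin' : IsFiniteMeasure (ENNReal.ofReal c • (Measure.dirac 0 : Measure ℝ)) :=
    Measure.smul_finite _ ENNReal.ofReal_ne_top
  have hbdd : ∀ m : Measure ℝ, IsFiniteMeasure m →
      Integrable (fun x : ℝ => Complex.exp (u * x * Complex.I)) m := fun m _ =>
    Integrable.of_bound (by fun_prop) 1 (ae_of_all _ fun x => by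
      rw [← Complex.ofReal_mul, Complex.norm_exp_ofReal_mul_I])
  rw [charFun_apply_real, differenceMeasure, integral_add_measure (hbdd _ hfin) (hbdd _ hfin'),
    integral_smul_measure, integral_dirac,
    integral_withDensity_eq_integral_toReal_smul (by fun_prop)
      (ae_of_all _ fun _ => ENNReal.ofReal_lt_top)]
  have hI := hν.integrable_levyIntegrand
  have key : ∫ z, (ENNReal.ofReal (2 - 2 * Real.cos z)).toReal •
      Complex.exp (u * z * Complex.I) ∂ν =
      2 * ∫ z, levyIntegrand u z ∂ν - ∫ z, levyIntegrand (u + 1) z ∂ν -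
        ∫ z, levyIntegrand (u - 1) z ∂ν := by
    have hsub : Integrable (fun z => 2 * levyIntegrand u z - levyIntegrand (u + 1) z) ν :=
      ((hI u).const_mul 2).sub (hI _)
    rw [← integral_const_mul, ← integral_sub ((hI u).const_mul 2) (hI _),
      ← integral_sub hsub (hI _)]
    refine integral_congr_ae (ae_of_all _ fun z => ?_)
    beta_reduce
    rw [ENNReal.toReal_ofReal (two_sub_two_cos_nonneg z), second_difference_levyIntegrand]
  rw [key, ENNReal.toReal_ofReal hc]
  change _ = 2 * (_ + ∫ z, levyIntegrand u z ∂ν) - (_ + ∫ z, levyIntegrand (u + 1) z ∂ν) -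
    (_ + ∫ z, levyIntegrand (u - 1) z ∂ν)
  simp only [Complex.real_smul, Complex.ofReal_zero, mul_zero, zero_mul, Complex.exp_zero]
  push_cast
  ring

/-- Equality at a single time leaves a multiple of `2πi` undetermined; the derivative in `t` removes
the ambiguity. -/
lemma eq_of_forall_exp_mul_eq {v w : ℂ}
    (h : ∀ t : ℝ≥0, Complex.exp ((t : ℝ) * v) = Complex.exp ((t : ℝ) * w)) : v = w := by
  have hd : ∀ v : ℂ, HasDerivAt (fun t : ℝ => Complex.exp ((t : ℂ) * v))
      (Complex.exp (((1 : ℝ) : ℂ) * v) * v) 1 := fun v => by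
    have h0 : HasDerivAt (fun t : ℝ => (t : ℂ)) 1 1 := Complex.ofRealCLM.hasDerivAt
    simpa using (h0.mul_const v).cexp
  have heq : (fun t : ℝ => Complex.exp ((t : ℂ) * v)) =ᶠ[𝓝 1]
      fun t : ℝ => Complex.exp ((t : ℂ) * w) := by
    filter_upwards [lt_mem_nhds (zero_lt_one' ℝ)] with t ht
    exact h ⟨t, ht.le⟩
  have h1 := (hd v).unique ((hd w).congr_of_eventuallyEq heq)
  have h2 : Complex.exp (((1 : ℝ) : ℂ) * v) = Complex.exp (((1 : ℝ) : ℂ) * w) := h 1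
  rw [h2] at h1
  exact mul_left_cancel₀ (Complex.exp_ne_zero _) h1

/-- The weight `2 - 2 cos z` is positive on `[-1, 1]` away from `0` and can be divided out there.
Its zeros at other multiples of `2π` do no harm, and the origin contributes nothing because `p > 0`.
-/
lemma setLIntegral_rpow_eq_differenceMeasure {ν : Measure ℝ} (c : ℝ)
    {p : ℝ} (hp : 0 < p) :
    ∫⁻ z in Set.Icc (-1 : ℝ) 1, ENNReal.ofReal (|z| ^ p) ∂ν =
      ∫⁻ z in Set.Icc (-1 : ℝ) 1 \ {0},
        ENNReal.ofReal (|z| ^ p / (2 - 2 * Real.cos z)) ∂(differenceMeasure c ν) := by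
  have hS : MeasurableSet (Set.Icc (-1 : ℝ) 1 \ {0}) :=
    measurableSet_Icc.diff (measurableSet_singleton 0)
  rw [differenceMeasure, Measure.restrict_add, lintegral_add_measure, Measure.restrict_smul,
    Measure.restrict_eq_zero.2 (by simp : (Measure.dirac (0 : ℝ)) (Set.Icc (-1 : ℝ) 1 \ {0}) = 0),
    restrict_withDensity hS,
    lintegral_withDensity_eq_lintegral_mul _ (by fun_prop)
      (by
        apply Measurable.ennreal_ofReal
        exact ((measurable_norm (α := ℝ)).pow_const p).div (by fun_prop))]
  simp only [smul_zero, lintegral_zero_measure, add_zero]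
  rw [← lintegral_indicator measurableSet_Icc, ← lintegral_indicator hS]
  refine lintegral_congr fun z => ?_
  by_cases hz : z ∈ Set.Icc (-1 : ℝ) 1
  · by_cases h0 : z = 0
    · subst h0
      simp [hp.ne']
    · rw [Set.indicator_of_mem hz, Set.indicator_of_mem (show z ∈ Set.Icc (-1 : ℝ) 1 \ {0} from ⟨hz, h0⟩)]
      have hpos : 0 < 2 - 2 * Real.cos z := by
        have hne : Real.cos z ≠ 1 := fun h => h0 <|
          (Real.cos_eq_one_iff_of_lt_of_lt (by linarith [Real.pi_gt_three, hz.1])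
            (by linarith [Real.pi_gt_three, hz.2])).1 h
        linarith [lt_of_le_of_ne (Real.cos_le_one z) hne]
      rw [Pi.mul_apply, ← ENNReal.ofReal_mul hpos.le, mul_div_cancel₀ _ hpos.ne']
  · rw [Set.indicator_of_notMem hz, Set.indicator_of_notMem fun h => hz h.1]

/-- The Blumenthal–Getoor index can be computed from any Lévy measure of the process. -/
theorem HasLevyMeasure.bgIndex_eq {Ω : Type*} [MeasurableSpace Ω] {P : Measure Ω}
    {Z : ℝ≥0 → Ω → ℝ} {ρ : Measure ℝ} (h : HasLevyMeasure P Z ρ) :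
    bgIndex P Z = sInf {p : ℝ | 0 < p ∧
      ∫⁻ z in Set.Icc (-1 : ℝ) 1, ENNReal.ofReal (|z| ^ p) ∂ρ < ∞} := by
  have hex : ∃ ν, HasLevyMeasure P Z ν := ⟨ρ, h⟩
  have hspec : HasLevyMeasure P Z (levyMeasure P Z) := by
    rw [levyMeasure, dif_pos hex]
    exact hex.choose_spec
  obtain ⟨h1, b, c, hc, hch⟩ := h
  obtain ⟨h2, b', c', hc', hch'⟩ := hspec
  -- The drifts and Gaussian coefficients of the two triplets need not be compared, only their
  -- exponents.
  have hψ : ∀ u, charExponent b c ρ u = charExponent b' c' (levyMeasure P Z) u := fun u =>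
    eq_of_forall_exp_mul_eq fun t => by rw [← hch, ← hch']
  have hdiff : differenceMeasure c ρ = differenceMeasure c' (levyMeasure P Z) := by
    have := h1.isFiniteMeasure_differenceMeasure c
    have := h2.isFiniteMeasure_differenceMeasure c'
    refine Measure.ext_of_charFun (funext fun u => ?_)
    rw [h1.charFun_differenceMeasure b hc, h2.charFun_differenceMeasure b' hc']
    simp only [hψ]
  rw [bgIndex]
  congr 1
  ext p
  simp only [Set.mem_ofPred_eq]
  refine and_congr_right fun hp => ?_
  rw [setLIntegral_rpow_eq_differenceMeasure c' hp, setLIntegral_rpow_eq_differenceMeasure c hp,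
    hdiff]

/-! ### From the Laplace transform of a subordinator to its characteristic function -/

/-- The Lévy measures of subordinators. -/
structure IsClockMeasure (ν : Measure ℝ) : Prop where
  support : ν (Set.Iic 0) = 0
  finite : ∫⁻ z, ENNReal.ofReal (min z 1) ∂ν < ∞

/-- The exponent `d w + ∫ (e^{wz} - 1) ν(dz)` of a subordinator, for complex `w` with `Re w ≤ 0`. -/
def clockExponent (d : ℝ) (ν : Measure ℝ) (w : ℂ) : ℂ :=
  d * w + ∫ z : ℝ, (Complex.exp (w * z) - 1) ∂ν

lemma HasDriftAndLevyMeasure.isClockMeasure {Ω : Type*} [MeasurableSpace Ω] {P : Measure Ω}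
    {X : ℝ≥0 → Ω → ℝ} {d : ℝ} {ν : Measure ℝ} (h : HasDriftAndLevyMeasure P X d ν) :
    IsClockMeasure ν := ⟨h.support, h.finite⟩

namespace IsClockMeasure

variable {ν : Measure ℝ}

lemma ae_pos (hν : IsClockMeasure ν) : ∀ᵐ z ∂ν, 0 < z := by
  rw [ae_iff]
  simpa [not_lt, Set.Iic] using hν.support

lemma lintegral_abs_lt_top (hν : IsClockMeasure ν) :
    ∫⁻ z, ENNReal.ofReal (min |z| 1) ∂ν < ∞ := by
  refine lt_of_eq_of_lt (lintegral_congr_ae ?_) hν.finite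
  filter_upwards [hν.ae_pos] with z hz
  rw [abs_of_pos hz]

/-- Needed for product measures. The measure `(z ∧ 1) ν(dz)` is finite with an almost everywhere
positive density, so `ν` is recovered from it by the inverse density. -/
lemma sFinite (hν : IsClockMeasure ν) : SFinite ν := by
  have hfin : IsFiniteMeasure (ν.withDensity fun z => ENNReal.ofReal (min z 1)) :=
    isFiniteMeasure_withDensity hν.finite.ne
  rw [← withDensity_inv_same (μ := ν) (f := fun z => ENNReal.ofReal (min z 1)) (by fun_prop)
    (by
      filter_upwards [hν.ae_pos] with z hz
      simpa using hz)
    (ae_of_all _ fun _ => ENNReal.ofReal_ne_top)]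
  infer_instance

end IsClockMeasure

lemma measurable_min_abs : Measurable (fun z : ℝ => min |z| 1) :=
  (measurable_norm (α := ℝ)).min measurable_const

lemma min_abs_nonneg (z : ℝ) : 0 ≤ min |z| 1 := by positivity

lemma norm_exp_sub_one_le_of_re_nonpos {v : ℂ} (hv : v.re ≤ 0) :
    ‖Complex.exp v - 1‖ ≤ 2 * min ‖v‖ 1 := by
  have h2 : ‖Complex.exp v - 1‖ ≤ 2 := by
    refine (norm_sub_le _ _).trans ?_
    have := Real.exp_le_one_iff.2 hv
    rw [Complex.norm_exp, norm_one]
    linarith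
  rcases le_or_gt ‖v‖ 1 with h | h
  · rw [min_eq_left h]
    exact Complex.norm_exp_sub_one_le h
  · rw [min_eq_right h.le]
    linarith

lemma min_mul_le {a z C : ℝ} (hz : 0 ≤ z) (haC : a ≤ C) (hC : 1 ≤ C) :
    min (a * z) 1 ≤ C * min z 1 := by
  rcases le_total z 1 with h | h
  · rw [min_eq_left h]
    exact (min_le_left _ _).trans (mul_le_mul_of_nonneg_right haC hz)
  · rw [min_eq_right h]
    exact (min_le_right _ _).trans (by linarith)

lemma norm_exp_mul_sub_one_le {w : ℂ} (hw : w.re ≤ 0) {C : ℝ} (hwC : ‖w‖ ≤ C) (hC : 1 ≤ C) {z : ℝ}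
    (hz : 0 ≤ z) : ‖Complex.exp (w * z) - 1‖ ≤ 2 * C * min |z| 1 := by
  refine (norm_exp_sub_one_le_of_re_nonpos ?_).trans ?_
  · rw [Complex.re_mul_ofReal]
    exact mul_nonpos_of_nonpos_of_nonneg hw hz
  · rw [norm_mul, Complex.norm_real, Real.norm_eq_abs, mul_assoc]
    gcongr
    exact min_mul_le (abs_nonneg z) hwC hC

namespace IsClockMeasure

variable {ν : Measure ℝ}

lemma integrable_min_abs (hν : IsClockMeasure ν) : Integrable (fun z : ℝ => min |z| 1) ν :=
  integrable_of_norm_le_const_mul measurable_min_abs min_abs_nonneg hν.lintegral_abs_lt_top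
    measurable_min_abs.aestronglyMeasurable (C := 1)
    (ae_of_all _ fun z => by rw [Real.norm_of_nonneg (min_abs_nonneg z), one_mul])

lemma integrable_exp_sub_one (hν : IsClockMeasure ν) {w : ℂ} (hw : w.re ≤ 0) :
    Integrable (fun z : ℝ => Complex.exp (w * z) - 1) ν := by
  refine integrable_of_norm_le_const_mul measurable_min_abs min_abs_nonneg hν.lintegral_abs_lt_top
    (by fun_prop) (C := 2 * (‖w‖ + 1)) ?_
  filter_upwards [hν.ae_pos] with z hz
  exact norm_exp_mul_sub_one_le hw (by linarith) (by linarith [norm_nonneg w]) hz.le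

lemma integrable_real_exp_sub_one (hν : IsClockMeasure ν) {u : ℝ} (hu : 0 ≤ u) :
    Integrable (fun z : ℝ => Real.exp (-(u * z)) - 1) ν := by
  have h := (hν.integrable_exp_sub_one (w := ((-u : ℝ) : ℂ)) (by simpa using hu)).re
  refine h.congr (ae_of_all _ fun z => ?_)
  change (Complex.exp (((-u : ℝ) : ℂ) * z) - 1).re = _
  rw [← Complex.ofReal_mul, ← Complex.ofReal_exp, Complex.sub_re, Complex.ofReal_re, Complex.one_re,
    neg_mul]

lemma clockExponent_neg (d : ℝ) (u : ℝ) :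
    clockExponent d ν ((-u : ℝ) : ℂ) =
      ((-(d * u) + ∫ z, (Real.exp (-(u * z)) - 1) ∂ν : ℝ) : ℂ) := by
  rw [clockExponent, Complex.ofReal_add, ← integral_complex_ofReal]
  push_cast
  congr 1
  · ring
  · refine integral_congr_ae (ae_of_all _ fun z => ?_)
    simp

/-- Continuity up to the imaginary axis, where the exponent is no longer known to be differentiable.
The bound on `e^{wz} - 1` is uniform over bounded `w` in the closed left half-plane. -/
lemma tendsto_clockExponent (hν : IsClockMeasure ν) (d : ℝ) {w : ℕ → ℂ} {w₀ : ℂ}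
    (hw : ∀ n, (w n).re ≤ 0) (hlim : Tendsto w atTop (𝓝 w₀)) :
    Tendsto (fun n => clockExponent d ν (w n)) atTop (𝓝 (clockExponent d ν w₀)) := by
  refine (hlim.const_mul _).add ?_
  have hle : ∀ᶠ n in atTop, ‖w n‖ ≤ ‖w₀‖ + 1 := by
    filter_upwards [hlim.norm.eventually (gt_mem_nhds (lt_add_one ‖w₀‖))] with n hn using hn.le
  refine tendsto_integral_filter_of_dominated_convergence
    (fun z => 2 * (‖w₀‖ + 1) * min |z| 1) ?_ ?_ (hν.integrable_min_abs.const_mul _) ?_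
  · exact Eventually.of_forall fun n => by fun_prop
  · filter_upwards [hle] with n hn
    filter_upwards [hν.ae_pos] with z hz
    exact norm_exp_mul_sub_one_le (hw n) hn (by linarith [norm_nonneg w₀]) hz.le
  · refine ae_of_all _ fun z => ?_
    exact (((Complex.continuous_exp.tendsto _).comp (hlim.mul_const _))).sub_const 1

/-- Dominates the derivative of `e^{wz}` for `Re w < -ε`: small jumps enter linearly, and for large
ones `εz e^{-εz} ≤ 1`. -/
lemma mul_exp_neg_le {ε z : ℝ} (hε : 0 < ε) (hz : 0 < z) :
    z * Real.exp (-(ε * z)) ≤ (1 + ε⁻¹) * min |z| 1 := by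
  have he : Real.exp (-(ε * z)) ≤ 1 := Real.exp_le_one_iff.2 (by nlinarith)
  rw [abs_of_pos hz]
  have hε' : 0 < ε⁻¹ := inv_pos.2 hε
  rcases le_total z 1 with h | h
  · rw [min_eq_left h]
    nlinarith [Real.exp_pos (-(ε * z))]
  · rw [min_eq_right h, mul_one]
    have h1 : ε * z * Real.exp (-(ε * z)) ≤ 1 := by
      rw [Real.exp_neg, ← div_eq_mul_inv, div_le_one (Real.exp_pos _)]
      linarith [Real.add_one_le_exp (ε * z)]
    have h2 : z * Real.exp (-(ε * z)) = ε⁻¹ * (ε * z * Real.exp (-(ε * z))) := by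
      field_simp
    rw [h2]
    nlinarith

lemma differentiableAt_clockExponent (hν : IsClockMeasure ν) (d : ℝ) {w₀ : ℂ} (hw : w₀.re < 0) :
    DifferentiableAt ℂ (clockExponent d ν) w₀ := by
  -- Half the distance from `w₀` to the imaginary axis, so that the decay `e^{-εz}` holds throughout
  -- a neighbourhood of `w₀`.
  have hε : 0 < -w₀.re / 2 := by linarith
  set ε := -w₀.re / 2 with hεdef
  have hs : {w : ℂ | w.re < -ε} ∈ 𝓝 w₀ := by
    refine (isOpen_lt Complex.continuous_re continuous_const).mem_nhds ?_
    change w₀.re < -ε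
    linarith
  have hint := hasDerivAt_integral_of_dominated_loc_of_deriv_le (μ := ν) (𝕜 := ℂ)
    (F := fun w (z : ℝ) => Complex.exp (w * z) - 1) (F' := fun w z => Complex.exp (w * z) * z)
    (bound := fun z => (1 + ε⁻¹) * min |z| 1) hs
    (Eventually.of_forall fun w => by fun_prop) (hν.integrable_exp_sub_one hw.le)
    (by fun_prop) ?_ (hν.integrable_min_abs.const_mul _) ?_
  · exact (differentiableAt_id.const_mul _).add hint.2.differentiableAt
  · filter_upwards [hν.ae_pos] with z hz w hws
    have hws' : w.re < -ε := hws
    rw [norm_mul, Complex.norm_real, Complex.norm_exp, Complex.re_mul_ofReal,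
      Real.norm_of_nonneg hz.le, mul_comm]
    refine le_trans ?_ (mul_exp_neg_le hε hz)
    gcongr
    nlinarith
  · refine ae_of_all _ fun z w _ => ?_
    have h := ((hasDerivAt_id w).mul_const (z : ℂ)).cexp.sub_const 1
    simpa using h

end IsClockMeasure

/-! ### Time dependence of the Laplace transform, and its analytic continuation -/

section Subordinator

variable {Ω : Type*} [MeasurableSpace Ω] {P : Measure Ω} {X : ℝ≥0 → Ω → ℝ}

lemma IsSubordinator.ae_nonneg (hX : IsSubordinator P X) : ∀ᵐ ω ∂P, ∀ t, 0 ≤ X t ω := by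
  filter_upwards [hX.levy.zero, hX.mono] with ω h0 hm t
  rw [← h0]
  exact hm (zero_le)

lemma integrable_exp_neg_mul [IsFiniteMeasure P] {V : Ω → ℝ} (hVm : AEMeasurable V P)
    (hV : ∀ᵐ ω ∂P, 0 ≤ V ω) {u : ℝ} (hu : 0 ≤ u) :
    Integrable (fun ω => Real.exp (-(u * V ω))) P := by
  refine Integrable.of_bound (by fun_prop) 1 ?_
  filter_upwards [hV] with ω h
  rw [Real.norm_of_nonneg (Real.exp_pos _).le, Real.exp_le_one_iff]
  have := mul_nonneg hu h
  linarith

lemma IsLevyProcess.laplace_sub (hX : IsLevyProcess P X) {s t : ℝ≥0} (hst : s ≤ t) (u : ℝ) :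
    ∫ ω, Real.exp (-(u * (X t ω - X s ω))) ∂P = laplace P (X (t - s)) u := by
  have h := ((hX.stationary s (t - s)).comp
    (u := fun x : ℝ => Real.exp (-(u * x))) (by fun_prop)).integral_eq
  rw [add_tsub_cancel_of_le hst] at h
  exact h

lemma IsLevyProcess.laplace_add (hX : IsLevyProcess P X) (s t : ℝ≥0) (u : ℝ) :
    laplace P (X (s + t)) u = laplace P (X s) u * laplace P (X t) u := by
  have hind := hX.indep.indepFun_eval_sub (zero_le : 0 ≤ s) (le_self_add : s ≤ s + t) hX.zero
  have hm := hX.measurable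
  have h := hind.integral_fun_comp_mul_comp (𝕜 := ℝ) (f := fun x : ℝ => Real.exp (-(u * x)))
    (g := fun x : ℝ => Real.exp (-(u * x))) (hm s).aemeasurable
    ((hm _).sub (hm _)).aemeasurable (by fun_prop) (by fun_prop)
  have h2 := hX.laplace_sub (le_self_add : s ≤ s + t) u
  rw [add_tsub_cancel_left] at h2
  change _ = _ * ∫ ω, Real.exp (-(u * (X (s + t) ω - X s ω))) ∂P at h
  rw [h2] at h
  rw [show laplace P (X s) u = ∫ ω, Real.exp (-(u * X s ω)) ∂P from rfl, ← h]
  refine integral_congr_ae (ae_of_all _ fun ω => ?_)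
  simp only [Pi.sub_apply]
  rw [← Real.exp_add]
  congr 1
  ring

variable [IsProbabilityMeasure P]

lemma IsSubordinator.laplace_pos (hX : IsSubordinator P X) (t : ℝ≥0) {u : ℝ} (hu : 0 ≤ u) :
    0 < laplace P (X t) u :=
  integral_exp_pos (integrable_exp_neg_mul (hX.levy.measurable t).aemeasurable
    (hX.ae_nonneg.mono fun _ h => h t) hu)

lemma IsSubordinator.laplace_le_one (hX : IsSubordinator P X) (t : ℝ≥0) {u : ℝ} (hu : 0 ≤ u) :
    laplace P (X t) u ≤ 1 := by
  have h : laplace P (X t) u ≤ ∫ _, (1 : ℝ) ∂P := by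
    refine integral_mono_ae (integrable_exp_neg_mul (hX.levy.measurable t).aemeasurable
      (hX.ae_nonneg.mono fun _ h => h t) hu) (integrable_const _) ?_
    filter_upwards [hX.ae_nonneg] with ω hω
    exact Real.exp_le_one_iff.2 (by have := mul_nonneg hu (hω t); linarith)
  simpa using h

/-- Cauchy's functional equation, with monotonicity in place of continuity: trapping `n t` between
`⌊n t⌋` and `⌊n t⌋ + 1` gives `n |h t - t h 1| ≤ h 1` for every `n`. -/
lemma monotone_additive_eq_mul {h : ℝ≥0 → ℝ} (hadd : ∀ s t, h (s + t) = h s + h t)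
    (hmono : Monotone h) (t : ℝ≥0) : h t = t * h 1 := by
  have h0 : h 0 = 0 := by simpa using hadd 0 0
  have hnat : ∀ (n : ℕ) (s : ℝ≥0), h (n * s) = n * h s := by
    intro n s
    induction n with
    | zero => simp [h0]
    | succ k ih => push_cast; rw [add_mul, one_mul, hadd, ih]; ring
  have h1 : 0 ≤ h 1 := h0 ▸ hmono zero_le
  have key : ∀ n : ℕ, |h t - t * h 1| * n ≤ h 1 := by
    intro n
    have hfl : (⌊(n : ℝ≥0) * t⌋₊ : ℝ) ≤ n * t := by
      exact_mod_cast Nat.floor_le (zero_le : 0 ≤ (n : ℝ≥0) * t)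
    have hfl' : (n : ℝ) * t ≤ ⌊(n : ℝ≥0) * t⌋₊ + 1 := by
      exact_mod_cast (Nat.lt_floor_add_one ((n : ℝ≥0) * t)).le
    have ha : (⌊(n : ℝ≥0) * t⌋₊ : ℝ) * h 1 ≤ n * h t := by
      have := hmono (Nat.floor_le (zero_le : 0 ≤ (n : ℝ≥0) * t))
      rw [hnat] at this
      simpa [hnat] using (hnat ⌊(n : ℝ≥0) * t⌋₊ 1 ▸ by simpa using this)
    have hb : (n : ℝ) * h t ≤ (⌊(n : ℝ≥0) * t⌋₊ + 1) * h 1 := by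
      have := hmono (Nat.lt_floor_add_one ((n : ℝ≥0) * t)).le
      have h3 := hnat (⌊(n : ℝ≥0) * t⌋₊ + 1) 1
      rw [hnat] at this
      push_cast at h3
      rw [mul_one] at h3
      linarith
    rw [← abs_of_nonneg (Nat.cast_nonneg n : (0 : ℝ) ≤ n), ← abs_mul, abs_le]
    constructor <;> nlinarith
  by_contra hne
  have hpos : 0 < |h t - t * h 1| := abs_pos.2 (sub_ne_zero.2 hne)
  obtain ⟨n, hn⟩ := exists_nat_gt (h 1 / |h t - t * h 1|)
  rw [div_lt_iff₀ hpos] at hn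
  linarith [key n]

/-- Stationary independent increments make `-log` of the transform additive in time. It is also
nonnegative, hence monotone, so it is linear in `t`. -/
theorem IsSubordinator.log_laplace (hX : IsSubordinator P X) (t : ℝ≥0) {u : ℝ} (hu : 0 ≤ u) :
    Real.log (laplace P (X t) u) = t * Real.log (laplace P (X 1) u) := by
  have hadd : ∀ s t, -Real.log (laplace P (X (s + t)) u) =
      -Real.log (laplace P (X s) u) + -Real.log (laplace P (X t) u) := fun s t => by
    rw [hX.levy.laplace_add, Real.log_mul (hX.laplace_pos s hu).ne' (hX.laplace_pos t hu).ne']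
    ring
  have hmono : Monotone fun t => -Real.log (laplace P (X t) u) := fun s t hst => by
    have h := hadd s (t - s)
    rw [add_tsub_cancel_of_le hst] at h
    have h2 := Real.log_nonpos (hX.laplace_pos (t - s) hu).le (hX.laplace_le_one (t - s) hu)
    simp only
    linarith
  have := monotone_additive_eq_mul hadd hmono t
  linarith

lemma IsSubordinator.laplace_eq_exp (hX : IsSubordinator P X) (t : ℝ≥0) {u : ℝ} (hu : 0 ≤ u) :
    laplace P (X t) u = Real.exp (t * Real.log (laplace P (X 1) u)) := by
  rw [← hX.log_laplace t hu, Real.exp_log (hX.laplace_pos t hu)]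

/-- The characteristic function of a subordinator, from its Laplace transform at time `1`. -/
theorem IsSubordinator.integral_cexp (hX : IsSubordinator P X) {d : ℝ} {ν : Measure ℝ}
    (hν : HasDriftAndLevyMeasure P X d ν) (t : ℝ≥0) (u : ℝ) :
    ∫ ω, Complex.exp (Complex.I * u * X t ω) ∂P =
      Complex.exp ((t : ℝ) * clockExponent d ν (Complex.I * u)) := by
  have hνc := hν.isClockMeasure
  have hXm := (hX.levy.measurable t).aemeasurable (μ := P)
  have hX0 : ∀ᵐ ω ∂P, 0 ≤ X t ω := hX.ae_nonneg.mono fun _ h => h t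
  have hset : Set.Iio 0 ⊆ interior (integrableExpSet (X t) P) := by
    refine interior_maximal (fun x hx => ?_) isOpen_Iio
    have hx' : x < 0 := hx
    have := integrable_exp_neg_mul hXm hX0 (u := -x) (by linarith)
    simpa [integrableExpSet] using this
  have hopen : IsOpen {w : ℂ | w.re < 0} := isOpen_lt Complex.continuous_re continuous_const
  have hF1 : AnalyticOnNhd ℂ (complexMGF (X t) P) {w : ℂ | w.re < 0} :=
    analyticOnNhd_complexMGF.mono fun w hw => hset hw
  have hF2 : AnalyticOnNhd ℂ (fun w => Complex.exp ((t : ℝ) * clockExponent d ν w))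
      {w : ℂ | w.re < 0} := by
    refine DifferentiableOn.analyticOnNhd (fun w hw => ?_) hopen
    exact ((hνc.differentiableAt_clockExponent d hw).const_mul _).cexp.differentiableWithinAt
  have hreal : ∀ x : ℝ, x < 0 →
      complexMGF (X t) P x = Complex.exp ((t : ℝ) * clockExponent d ν x) := by
    intro x hx
    have h1 := hX.laplace_eq_exp t (u := -x) (by linarith)
    rw [hν.laplace_eq (-x) (by linarith), Real.log_exp] at h1
    have h2 := IsClockMeasure.clockExponent_neg (ν := ν) d (-x)
    rw [neg_neg] at h2
    rw [complexMGF_ofReal, h2, ← Complex.ofReal_mul, ← Complex.ofReal_exp, ← h1]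
    congr 1
    refine integral_congr_ae (ae_of_all _ fun ω => ?_)
    simp
  -- Identity theorem: both functions are analytic on the open left half-plane and agree on the
  -- negative real axis, which accumulates at `-1`.
  have hEq : Set.EqOn (complexMGF (X t) P)
      (fun w => Complex.exp ((t : ℝ) * clockExponent d ν w)) {w : ℂ | w.re < 0} := by
    refine hF1.eqOn_of_preconnected_of_frequently_eq hF2
      (convex_halfSpace_re_lt 0).isPreconnected (z₀ := ((-1 : ℝ) : ℂ)) (by simp) ?_
    have htend : Tendsto (fun x : ℝ => (x : ℂ)) (𝓝[≠] (-1)) (𝓝[≠] ((-1 : ℝ) : ℂ)) := by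
      refine tendsto_nhdsWithin_iff.2 ⟨(Complex.continuous_ofReal.tendsto _).mono_left
        nhdsWithin_le_nhds, ?_⟩
      filter_upwards [self_mem_nhdsWithin] with x hx
      simpa using fun h : (x : ℂ) = -1 => hx (by exact_mod_cast h)
    refine htend.frequently (Eventually.frequently ?_)
    filter_upwards [nhdsWithin_le_nhds (gt_mem_nhds (show (-1 : ℝ) < 0 by norm_num))] with x hx
    exact hreal x hx
  -- The imaginary axis is the boundary of the half-plane, so the identity is carried there by a
  -- limit from inside.
  let w : ℕ → ℂ := fun n => Complex.I * u - ((1 / ((n : ℝ) + 1) : ℝ) : ℂ)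
  have hwre : ∀ n, (w n).re < 0 := fun n => by
    have : 0 < 1 / ((n : ℝ) + 1) := by positivity
    simp only [w, Complex.sub_re, Complex.mul_re, Complex.I_re, Complex.I_im, Complex.ofReal_re,
      Complex.ofReal_im]
    linarith
  have hwlim : Tendsto w atTop (𝓝 (Complex.I * u)) := by
    have h := (Complex.continuous_ofReal.tendsto 0).comp
      (tendsto_one_div_add_atTop_nhds_zero_nat (𝕜 := ℝ))
    simpa [w] using h.const_sub (Complex.I * u)
  have hlim2 : Tendsto (fun n => Complex.exp ((t : ℝ) * clockExponent d ν (w n))) atTop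
      (𝓝 (Complex.exp ((t : ℝ) * clockExponent d ν (Complex.I * u)))) :=
    (Complex.continuous_exp.tendsto _).comp
      ((hνc.tendsto_clockExponent d (fun n => (hwre n).le) hwlim).const_mul _)
  have hlim1 : Tendsto (fun n => complexMGF (X t) P (w n)) atTop
      (𝓝 (∫ ω, Complex.exp (Complex.I * u * X t ω) ∂P)) := by
    refine tendsto_integral_of_dominated_convergence (fun _ => 1) (fun n => by fun_prop)
      (integrable_const _) (fun n => ?_) (ae_of_all _ fun ω => ?_)
    · filter_upwards [hX0] with ω hω
      rw [Complex.norm_exp, Complex.re_mul_ofReal]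
      exact Real.exp_le_one_iff.2 (mul_nonpos_of_nonpos_of_nonneg (hwre n).le hω)
    · exact (Complex.continuous_exp.tendsto _).comp (hwlim.mul_const _)
  refine tendsto_nhds_unique hlim1 (hlim2.congr fun n => ?_)
  exact (hEq (hwre n)).symm

end Subordinator

/-! ### Scaling of Lévy measures -/

/-- The Blumenthal–Getoor exponents `p` of a Lévy measure, those with `∫_{|z| ≤ 1} |z|^p < ∞`. -/
def bgSet (ρ : Measure ℝ) : Set ℝ :=
  {p : ℝ | 0 < p ∧ ∫⁻ z in Set.Icc (-1 : ℝ) 1, ENNReal.ofReal (|z| ^ p) ∂ρ < ∞}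

/-- The image of `η ⊗ ν` under multiplication, without its mass at the origin. -/
def scaleMeasure (η ν : Measure ℝ) : Measure ℝ :=
  ((η.prod ν).map (fun q => q.1 * q.2)).restrict {0}ᶜ

lemma scaleMeasure_singleton_zero (η ν : Measure ℝ) : scaleMeasure η ν {0} = 0 := by
  rw [scaleMeasure, Measure.restrict_apply (measurableSet_singleton 0)]
  simp

/-- The product may charge the origin when `η` does, and a Lévy measure must not; `f 0 = 0` makes
the removed mass invisible. -/
lemma lintegral_scaleMeasure (η ν : Measure ℝ) [SFinite ν] {f : ℝ → ℝ≥0∞} (hf : Measurable f)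
    (hf0 : f 0 = 0) :
    ∫⁻ z, f z ∂(scaleMeasure η ν) = ∫⁻ a, ∫⁻ z, f (a * z) ∂ν ∂η := by
  have hind : ({0}ᶜ : Set ℝ).indicator f = f := by
    refine Set.indicator_eq_self.2 fun z hz h0 => hz ?_
    rw [Set.mem_singleton_iff.1 h0, hf0]
  have hfm : Measurable fun q : ℝ × ℝ => f (q.1 * q.2) := hf.comp (by fun_prop)
  rw [scaleMeasure, ← lintegral_indicator (measurableSet_singleton 0).compl, hind,
    lintegral_map hf (by fun_prop), lintegral_prod _ hfm.aemeasurable]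

lemma integral_scaleMeasure (η ν : Measure ℝ) [SFinite ν] [SFinite η] {E : Type*}
    [NormedAddCommGroup E] [NormedSpace ℝ E] {f : ℝ → E} (hf : StronglyMeasurable f)
    (hf0 : f 0 = 0) (hfi : Integrable f (scaleMeasure η ν)) :
    ∫ z, f z ∂(scaleMeasure η ν) = ∫ a, ∫ z, f (a * z) ∂ν ∂η := by
  have hsupp : Function.support f ⊆ {0}ᶜ := fun z hz h0 => hz (by
    rw [Set.mem_singleton_iff.1 h0, hf0])
  have hi : Integrable f ((η.prod ν).map (fun q => q.1 * q.2)) :=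
    (integrableOn_iff_integrable_of_support_subset hsupp).1 hfi
  have hi' : Integrable (fun q : ℝ × ℝ => f (q.1 * q.2)) (η.prod ν) :=
    (integrable_map_measure hf.aestronglyMeasurable (by fun_prop)).1 hi
  rw [scaleMeasure, setIntegral_eq_integral_of_forall_compl_eq_zero
    (fun z hz => by_contra fun h => hz (hsupp h)),
    integral_map (by fun_prop) hf.aestronglyMeasurable, integral_prod _ hi']

lemma measurable_ofReal_min_abs : Measurable fun z : ℝ => ENNReal.ofReal (min |z| 1) :=
  measurable_min_abs.ennreal_ofReal

lemma IsClockMeasure.lintegral_scaleMeasure_lt_top {ν : Measure ℝ} (hν : IsClockMeasure ν)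
    (η : Measure ℝ) [IsFiniteMeasure η] {C : ℝ} (hC : ∀ᵐ a ∂η, |a| ≤ C) :
    ∫⁻ z, ENNReal.ofReal (min |z| 1) ∂(scaleMeasure η ν) < ∞ := by
  have := hν.sFinite
  rw [lintegral_scaleMeasure η ν measurable_ofReal_min_abs (by simp)]
  have hle : ∀ᵐ a ∂η, ∫⁻ z, ENNReal.ofReal (min |a * z| 1) ∂ν ≤
      ENNReal.ofReal (max C 1) * ∫⁻ z, ENNReal.ofReal (min |z| 1) ∂ν := by
    filter_upwards [hC] with a ha
    rw [← lintegral_const_mul _ measurable_ofReal_min_abs]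
    refine lintegral_mono fun z => ?_
    rw [← ENNReal.ofReal_mul (by positivity), abs_mul]
    exact ENNReal.ofReal_le_ofReal
      (min_mul_le (abs_nonneg z) (ha.trans (le_max_left _ _)) (le_max_right _ _))
  refine (lintegral_mono_ae hle).trans_lt ?_
  rw [lintegral_const]
  exact ENNReal.mul_lt_top (ENNReal.mul_lt_top ENNReal.ofReal_lt_top hν.lintegral_abs_lt_top)
    (measure_lt_top _ _)

/-- The integrand `|z|^p 1_{|z| ≤ 1}`. -/
def truncPow (p z : ℝ) : ℝ≥0∞ :=
  (Set.Icc (-1 : ℝ) 1).indicator (fun z => ENNReal.ofReal (|z| ^ p)) z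

lemma measurable_truncPow (p : ℝ) : Measurable (truncPow p) :=
  ((measurable_norm (α := ℝ)).pow_const p).ennreal_ofReal.indicator measurableSet_Icc

lemma truncPow_zero {p : ℝ} (hp : 0 < p) : truncPow p 0 = 0 := by
  simp [truncPow, hp.ne']

lemma mem_bgSet {ρ : Measure ℝ} {p : ℝ} :
    p ∈ bgSet ρ ↔ 0 < p ∧ ∫⁻ z, truncPow p z ∂ρ < ∞ := by
  unfold truncPow
  rw [lintegral_indicator measurableSet_Icc]
  rfl

lemma mem_Icc_neg_one_one {z : ℝ} : z ∈ Set.Icc (-1 : ℝ) 1 ↔ |z| ≤ 1 := by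
  rw [Set.mem_Icc, abs_le]

lemma truncPow_le_one {p : ℝ} (hp : 0 < p) (z : ℝ) : truncPow p z ≤ 1 := by
  unfold truncPow
  by_cases hz : z ∈ Set.Icc (-1 : ℝ) 1
  · rw [Set.indicator_of_mem hz, ENNReal.ofReal_le_one]
    exact Real.rpow_le_one (abs_nonneg z) (mem_Icc_neg_one_one.1 hz) hp.le
  · rw [Set.indicator_of_notMem hz]
    exact zero_le

/-- A jump already in `[-1, 1]` gains at most the factor `C ^ p`. A larger jump brought into the
window counts at most `1`, which is its `min |z| 1`. -/
lemma truncPow_mul_le {p : ℝ} (hp : 0 < p) {a C : ℝ} (haC : |a| ≤ C) (z : ℝ) :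
    truncPow p (a * z) ≤
      ENNReal.ofReal (C ^ p) * truncPow p z + ENNReal.ofReal (min |z| 1) := by
  by_cases hz : |z| ≤ 1
  · refine le_add_right ?_
    by_cases haz : a * z ∈ Set.Icc (-1 : ℝ) 1
    · rw [truncPow, truncPow, Set.indicator_of_mem haz,
        Set.indicator_of_mem (mem_Icc_neg_one_one.2 hz),
        ← ENNReal.ofReal_mul (Real.rpow_nonneg ((abs_nonneg a).trans haC) _), abs_mul,
        Real.mul_rpow (abs_nonneg a) (abs_nonneg z)]
      gcongr
    · rw [truncPow, Set.indicator_of_notMem haz]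
      exact zero_le
  · refine le_add_left ?_
    rw [min_eq_right (not_le.1 hz).le, ENNReal.ofReal_one]
    exact truncPow_le_one hp _

/-- A jump that stays in the window is rescaled by exactly `|a| ^ p`. One pushed out satisfies `1 <
|a| |z|`, so the second term pays for it. -/
lemma truncPow_le_mul {p : ℝ} (hp : 0 < p) {a : ℝ} (ha : a ≠ 0) (z : ℝ) :
    truncPow p z ≤ ENNReal.ofReal ((|a| ^ p)⁻¹) * truncPow p (a * z) +
      ENNReal.ofReal |a| * ENNReal.ofReal (min |z| 1) := by
  have hap : 0 < |a| ^ p := Real.rpow_pos_of_pos (abs_pos.2 ha) p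
  by_cases hz : |z| ≤ 1
  · by_cases haz : |a * z| ≤ 1
    · refine le_add_right ?_
      rw [truncPow, truncPow, Set.indicator_of_mem (mem_Icc_neg_one_one.2 haz),
        Set.indicator_of_mem (mem_Icc_neg_one_one.2 hz), ← ENNReal.ofReal_mul (inv_pos.2 hap).le,
        abs_mul, Real.mul_rpow (abs_nonneg a) (abs_nonneg z), inv_mul_cancel_left₀ hap.ne']
    · refine le_add_left ((truncPow_le_one hp _).trans ?_)
      rw [min_eq_left hz, ← ENNReal.ofReal_mul (abs_nonneg a), ← abs_mul, ENNReal.one_le_ofReal]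
      exact (not_le.1 haz).le
  · rw [truncPow, Set.indicator_of_notMem fun h => hz (mem_Icc_neg_one_one.1 h)]
    exact zero_le

/-- Scaling by bounded factors that are not almost surely `0` keeps the Blumenthal–Getoor
exponents. -/
theorem IsClockMeasure.bgSet_scaleMeasure {ν : Measure ℝ} (hν : IsClockMeasure ν)
    (η : Measure ℝ) [IsFiniteMeasure η] {C : ℝ} (hC : ∀ᵐ a ∂η, |a| ≤ C) (hη : η {0}ᶜ ≠ 0) :
    bgSet (scaleMeasure η ν) = bgSet ν := by
  have := hν.sFinite
  ext p
  rw [mem_bgSet, mem_bgSet]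
  refine and_congr_right fun hp => ?_
  have hm := measurable_truncPow p
  rw [lintegral_scaleMeasure η ν hm (truncPow_zero hp)]
  constructor
  · intro h
    have hmeas : Measurable fun a : ℝ => ∫⁻ z, truncPow p (a * z) ∂ν :=
      (hm.comp (measurable_fst.mul measurable_snd)).lintegral_prod_right'
    have hae := ae_lt_top hmeas h.ne
    have hfreq : ∃ᵐ a ∂η, a ≠ 0 := by
      rw [frequently_ae_iff]
      exact hη
    -- One nonzero factor with finite inner integral suffices; it exists because the inner integral
    -- is finite almost everywhere and `η` is not concentrated at `0`.
    obtain ⟨a, ha0, ha⟩ := (hfreq.and_eventually hae).exists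
    refine (lintegral_mono fun z => truncPow_le_mul hp ha0 z).trans_lt ?_
    have hma : Measurable fun z => truncPow p (a * z) := hm.comp (measurable_const_mul a)
    rw [lintegral_add_right _ (measurable_ofReal_min_abs.const_mul _), lintegral_const_mul _ hma,
      lintegral_const_mul _ measurable_ofReal_min_abs]
    exact ENNReal.add_lt_top.2 ⟨ENNReal.mul_lt_top ENNReal.ofReal_lt_top ha,
      ENNReal.mul_lt_top ENNReal.ofReal_lt_top hν.lintegral_abs_lt_top⟩
  · intro h
    have hle : ∀ᵐ a ∂η, ∫⁻ z, truncPow p (a * z) ∂ν ≤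
        ENNReal.ofReal (C ^ p) * ∫⁻ z, truncPow p z ∂ν +
          ∫⁻ z, ENNReal.ofReal (min |z| 1) ∂ν := by
      filter_upwards [hC] with a ha
      rw [← lintegral_const_mul _ hm, ← lintegral_add_right _ measurable_ofReal_min_abs]
      exact lintegral_mono fun z => truncPow_mul_le hp ha z
    refine (lintegral_mono_ae hle).trans_lt ?_
    rw [lintegral_const]
    exact ENNReal.mul_lt_top (ENNReal.add_lt_top.2
      ⟨ENNReal.mul_lt_top ENNReal.ofReal_lt_top h, hν.lintegral_abs_lt_top⟩) (measure_lt_top _ _)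

/-! ### Lévy measures of subordinators and of their mixtures -/

section Mixture

variable {Ω : Type*} [MeasurableSpace Ω] {P : Measure Ω}

/-- A process whose exponent is a drift plus an integral over jumps of bounded variation. -/
lemma hasLevyMeasure_of_clockExponent {V : ℝ≥0 → Ω → ℝ} {b : ℝ} {ρ : Measure ℝ}
    (h0 : ρ {0} = 0) (hfin : ∫⁻ z, ENNReal.ofReal (min |z| 1) ∂ρ < ∞)
    (hV : ∀ (t : ℝ≥0) (u : ℝ), ∫ ω, Complex.exp (Complex.I * u * V t ω) ∂P =
      Complex.exp ((t : ℝ) * clockExponent b ρ (Complex.I * u))) :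
    HasLevyMeasure P V ρ := by
  refine ⟨⟨h0, lt_of_le_of_lt (lintegral_mono fun z => ENNReal.ofReal_le_ofReal ?_) hfin⟩,
    -- The compensator is integrable by itself, so it moves into the drift; there is no Gaussian
    -- part.
    b + ∫ z, (Set.Icc (-1 : ℝ) 1).indicator (fun y => y) z ∂ρ, 0, le_rfl, fun t u => ?_⟩
  · rw [← sq_abs]
    rcases le_total |z| 1 with h | h
    · rw [min_eq_left h]
      exact (min_le_left _ _).trans (by nlinarith [abs_nonneg z])
    · rw [min_eq_right h]
      exact min_le_right _ _
  · rw [hV]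
    congr 2
    have hi1 : Integrable (fun z : ℝ => Complex.exp (Complex.I * u * z) - 1) ρ := by
      refine integrable_of_norm_le_const_mul measurable_min_abs min_abs_nonneg hfin
        (by fun_prop) (C := 2 * (|u| + 1)) (ae_of_all _ fun z => ?_)
      refine (norm_exp_sub_one_le_of_re_nonpos (by simp)).trans ?_
      rw [mul_assoc 2]
      gcongr
      rw [norm_mul, Complex.norm_real, Real.norm_eq_abs]
      exact min_mul_le (abs_nonneg z) (by simp) (by linarith [abs_nonneg u])
    have hi2 : Integrable (fun z : ℝ => (Set.Icc (-1 : ℝ) 1).indicator (fun y => y) z) ρ := by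
      refine integrable_of_norm_le_const_mul measurable_min_abs min_abs_nonneg hfin
        (measurable_id.indicator measurableSet_Icc).aestronglyMeasurable (C := 1)
        (ae_of_all _ fun z => ?_)
      by_cases hz : z ∈ Set.Icc (-1 : ℝ) 1
      · rw [Set.indicator_of_mem hz, one_mul, min_eq_left (mem_Icc_neg_one_one.1 hz)]
        exact le_rfl
      · rw [Set.indicator_of_notMem hz, norm_zero, one_mul]
        exact min_abs_nonneg z
    have hi3 : Integrable
        (fun z : ℝ => (((Set.Icc (-1 : ℝ) 1).indicator (fun y => y) z : ℝ) : ℂ)) ρ := hi2.ofReal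
    rw [clockExponent, charExponent, integral_sub hi1 (hi3.const_mul _),
      integral_const_mul, integral_complex_ofReal]
    push_cast
    ring

lemma IsSubordinator.hasLevyMeasure [IsProbabilityMeasure P] {X : ℝ≥0 → Ω → ℝ}
    (hX : IsSubordinator P X) {d : ℝ} {ν : Measure ℝ} (hν : HasDriftAndLevyMeasure P X d ν) :
    HasLevyMeasure P X ν :=
  hasLevyMeasure_of_clockExponent
    (measure_mono_null (by simp) hν.support) hν.isClockMeasure.lintegral_abs_lt_top
    (hX.integral_cexp hν)

/-- The scaling factors of a constant mixture. -/
def mixtureScale (κ₁ κ₂ : ℝ) : Measure ℝ := Measure.dirac κ₁ + Measure.dirac (-κ₂)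

instance (κ₁ κ₂ : ℝ) : IsFiniteMeasure (mixtureScale κ₁ κ₂) := by
  unfold mixtureScale
  infer_instance

lemma mixtureScale_ae_le (κ₁ κ₂ : ℝ) : ∀ᵐ a ∂(mixtureScale κ₁ κ₂), |a| ≤ max |κ₁| |κ₂| := by
  have hS : MeasurableSet {a : ℝ | |a| ≤ max |κ₁| |κ₂|} :=
    measurableSet_le (measurable_norm (α := ℝ)) measurable_const
  rw [mixtureScale, ae_add_measure_iff, ae_dirac_iff hS, ae_dirac_iff hS, abs_neg]
  exact ⟨le_max_left _ _, le_max_right _ _⟩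

lemma mixtureScale_compl_ne_zero {κ₁ κ₂ : ℝ} (hκ : 0 < κ₁ + κ₂) :
    mixtureScale κ₁ κ₂ {0}ᶜ ≠ 0 := by
  intro h
  rw [mixtureScale, Measure.add_apply, add_eq_zero] at h
  simp only [Measure.dirac_apply, Set.indicator_apply_eq_zero, Set.mem_compl_iff,
    Set.mem_singleton_iff, Pi.one_apply, one_ne_zero, imp_false, not_not, neg_eq_zero] at h
  rw [h.1, h.2] at hκ
  simp at hκ

/-- On the imaginary axis the exponential is bounded for jumps of either sign, so the negative
factor `-κ₂` is treated like `κ₁`. -/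
lemma IsClockMeasure.clockExponent_mixture {ν : Measure ℝ} (hν : IsClockMeasure ν)
    (d m κ₁ κ₂ u : ℝ) :
    clockExponent (m + (κ₁ - κ₂) * d) (scaleMeasure (mixtureScale κ₁ κ₂) ν) (Complex.I * u) =
      Complex.I * u * m + clockExponent d ν (Complex.I * (u * κ₁ : ℝ)) +
        clockExponent d ν (Complex.I * (u * -κ₂ : ℝ)) := by
  have := hν.sFinite
  have hi : Integrable (fun z : ℝ => Complex.exp (Complex.I * u * z) - 1)
      (scaleMeasure (mixtureScale κ₁ κ₂) ν) := by
    refine integrable_of_norm_le_const_mul measurable_min_abs min_abs_nonneg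
      (hν.lintegral_scaleMeasure_lt_top _ (mixtureScale_ae_le κ₁ κ₂))
      (by fun_prop) (C := 2 * (|u| + 1)) (ae_of_all _ fun z => ?_)
    refine (norm_exp_sub_one_le_of_re_nonpos (by simp)).trans ?_
    rw [mul_assoc 2]
    gcongr
    rw [norm_mul, Complex.norm_real, Real.norm_eq_abs]
    exact min_mul_le (abs_nonneg z) (by simp) (by linarith [abs_nonneg u])
  simp only [clockExponent]
  rw [integral_scaleMeasure _ _ (by fun_prop) (by simp) hi, mixtureScale,
    integral_add_measure (integrable_dirac (by simp)) (integrable_dirac (by simp)),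
    integral_dirac, integral_dirac]
  push_cast
  simp only [mul_assoc]
  ring

lemma IsIndepCopy.integral_cexp {W W' : ℝ≥0 → Ω → ℝ} (h : IsIndepCopy P W W') (t : ℝ≥0)
    (v : ℝ) : ∫ ω, Complex.exp (Complex.I * v * W' t ω) ∂P =
      ∫ ω, Complex.exp (Complex.I * v * W t ω) ∂P :=
  (h.1.comp (u := fun x : ℝ≥0 → ℝ => Complex.exp (Complex.I * v * x t)) (by fun_prop)).integral_eq

/-- The Lévy measure of a constant mixture of subordinators. -/
theorem IsSubordinator.hasLevyMeasure_constantMixture [IsProbabilityMeasure P]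
    {W W' : ℝ≥0 → Ω → ℝ} (hW : IsSubordinator P W) (hW' : IsIndepCopy P W W') {d : ℝ}
    {ν : Measure ℝ} (hν : HasDriftAndLevyMeasure P W d ν) (m κ₁ κ₂ : ℝ) :
    HasLevyMeasure P (constantMixture m κ₁ κ₂ W W') (scaleMeasure (mixtureScale κ₁ κ₂) ν) := by
  refine hasLevyMeasure_of_clockExponent (b := m + (κ₁ - κ₂) * d)
    (scaleMeasure_singleton_zero _ _)
    (hν.isClockMeasure.lintegral_scaleMeasure_lt_top _ (mixtureScale_ae_le κ₁ κ₂))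
    fun t u => ?_
  have hm : Measurable fun x : ℝ≥0 → ℝ => x t := measurable_pi_apply t
  have hind := (hW'.2.comp hm hm).integral_fun_comp_mul_comp (𝕜 := ℂ)
    (f := fun x : ℝ => Complex.exp (Complex.I * (u * κ₁ : ℝ) * x))
    (g := fun x : ℝ => Complex.exp (Complex.I * (u * -κ₂ : ℝ) * x))
    (hm.comp_aemeasurable hW'.1.aemeasurable_snd) (hm.comp_aemeasurable hW'.1.aemeasurable_fst)
    (by fun_prop) (by fun_prop)
  simp only [Function.comp_apply] at hind
  rw [hW'.integral_cexp, hW.integral_cexp hν, hW.integral_cexp hν] at hind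
  rw [hν.isClockMeasure.clockExponent_mixture, mul_add, mul_add, Complex.exp_add, Complex.exp_add,
    mul_assoc, ← hind, ← integral_const_mul]
  refine integral_congr_ae (ae_of_all _ fun ω => ?_)
  simp only [constantMixture]
  rw [← Complex.exp_add, ← Complex.exp_add]
  congr 1
  push_cast
  ring

/-- A subordinator whose Laplace exponent averages that of `X` over scaling factors. -/
theorem HasDriftAndLevyMeasure.of_averaged_exponent [IsProbabilityMeasure P]
    {X W : ℝ≥0 → Ω → ℝ} {d : ℝ} {ν : Measure ℝ}
    (hν : HasDriftAndLevyMeasure P X d ν) (η : Measure ℝ) [IsFiniteMeasure η] {C : ℝ}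
    (h0 : ∀ᵐ a ∂η, 0 ≤ a) (hC : ∀ᵐ a ∂η, a ≤ C)
    (hW : ∀ u : ℝ, 0 ≤ u →
      laplace P (W 1) u = Real.exp (∫ a, Real.log (laplace P (X 1) (a * u)) ∂η)) :
    HasDriftAndLevyMeasure P W (d * ∫ a, a ∂η) (scaleMeasure η ν) := by
  have hνc := hν.isClockMeasure
  have := hνc.sFinite
  have hCabs : ∀ᵐ a ∂η, |a| ≤ C := by
    filter_upwards [h0, hC] with a h0 hC
    rwa [abs_of_nonneg h0]
  have hfin := hνc.lintegral_scaleMeasure_lt_top η hCabs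
  have hsupp : scaleMeasure η ν (Set.Iic 0) = 0 := by
    have hneg : scaleMeasure η ν (Set.Iio 0) = 0 := by
      rw [← lintegral_indicator_one measurableSet_Iio,
        lintegral_scaleMeasure η ν (measurable_one.indicator measurableSet_Iio) (by simp),
        lintegral_eq_zero_iff']
      · filter_upwards [h0] with a ha
        refine (lintegral_congr_ae ?_).trans lintegral_zero
        filter_upwards [hνc.ae_pos] with z hz
        simpa using mul_nonneg ha hz.le
      · exact (((measurable_one.indicator measurableSet_Iio).comp
          (measurable_fst.mul measurable_snd)).lintegral_prod_right').aemeasurable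
    rw [← Set.Iio_union_right]
    exact measure_union_null hneg (scaleMeasure_singleton_zero _ _)
  have hclock : IsClockMeasure (scaleMeasure η ν) :=
    ⟨hsupp, lt_of_le_of_lt (lintegral_mono fun z => ENNReal.ofReal_le_ofReal
      (min_le_min_right _ (le_abs_self z))) hfin⟩
  refine ⟨mul_nonneg hν.drift_nonneg (integral_nonneg_of_ae h0), hsupp, hclock.finite,
    fun u hu => ?_⟩
  have hid : Integrable (fun a : ℝ => a) η := Integrable.of_bound (by fun_prop) C hCabs
  have hexp : Integrable (fun z : ℝ => Real.exp (-(u * z)) - 1) (scaleMeasure η ν) :=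
    hclock.integrable_real_exp_sub_one hu
  -- Boundedness of the factors makes the inner integral bounded uniformly in `a`, and `η` is
  -- finite.
  have hexp' : Integrable (fun a : ℝ => ∫ z, (Real.exp (-(u * (a * z))) - 1) ∂ν) η := by
    have hmeas : StronglyMeasurable fun q : ℝ × ℝ => Real.exp (-(u * (q.1 * q.2))) - 1 := by
      fun_prop
    refine Integrable.of_bound hmeas.integral_prod_right.aestronglyMeasurable
      (∫ z, 2 * (|u| * |C| + 1) * min |z| 1 ∂ν) ?_
    filter_upwards [h0, hCabs] with a ha haC
    refine norm_integral_le_of_norm_le (hνc.integrable_min_abs.const_mul _) ?_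
    filter_upwards [hνc.ae_pos] with z hz
    have h1 := norm_exp_mul_sub_one_le (w := ((-(u * a) : ℝ) : ℂ)) (C := |u| * |C| + 1)
      (by simpa using mul_nonneg hu ha) (by
        rw [Complex.norm_real, norm_neg, norm_mul, Real.norm_eq_abs, Real.norm_eq_abs]
        have := mul_le_mul_of_nonneg_left (haC.trans (le_abs_self C)) (abs_nonneg u)
        linarith) (by have := mul_nonneg (abs_nonneg u) (abs_nonneg C); linarith) hz.le
    rw [← Complex.ofReal_mul, ← Complex.ofReal_exp, ← Complex.ofReal_one, ← Complex.ofReal_sub,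
      Complex.norm_real] at h1
    rwa [show -(u * (a * z)) = -(u * a) * z by ring]
  rw [hW u hu, integral_scaleMeasure η ν (by fun_prop) (by simp) hexp]
  congr 1
  have hint : ∫ a, Real.log (laplace P (X 1) (a * u)) ∂η =
      ∫ a, (-(d * u) * a + ∫ z, (Real.exp (-(u * (a * z))) - 1) ∂ν) ∂η := by
    refine integral_congr_ae ?_
    filter_upwards [h0] with a ha
    rw [hν.laplace_eq _ (mul_nonneg ha hu), Real.log_exp]
    congr 1
    · ring
    · refine integral_congr_ae (ae_of_all _ fun z => ?_)
      simp only
      rw [show a * u * z = u * (a * z) by ring]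
  rw [hint, integral_add (hid.const_mul _) hexp', integral_const_mul]
  ring

lemma measurable_log_laplace [IsFiniteMeasure P] {V : Ω → ℝ} (hV : Measurable V) (u : ℝ) :
    Measurable fun a : ℝ => Real.log (laplace P V (a * u)) := by
  have h : StronglyMeasurable fun q : ℝ × Ω => Real.exp (-(q.1 * u * V q.2)) := by
    apply Measurable.stronglyMeasurable
    fun_prop
  exact Real.measurable_log.comp h.integral_prod_right.measurable

/-- If the Laplace exponent of `W` averages that of `X` over scaling factors `h s`, then `W` has
the same Blumenthal–Getoor exponents as `X`. -/
theorem exists_driftAndLevyMeasure_of_laplace [IsProbabilityMeasure P]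
    {X W : ℝ≥0 → Ω → ℝ} (hX : IsSubordinator P X) {d : ℝ} {ν : Measure ℝ}
    (hν : HasDriftAndLevyMeasure P X d ν) (μ : Measure ℝ) [IsFiniteMeasure μ] {h : ℝ → ℝ}
    (hm : AEMeasurable h μ) {C : ℝ}
    (h0 : ∀ᵐ s ∂μ, 0 ≤ h s) (hC : ∀ᵐ s ∂μ, h s ≤ C) (hne : ¬ ∀ᵐ s ∂μ, h s = 0)
    (hW : ∀ u : ℝ, 0 ≤ u →
      laplace P (W 1) u = Real.exp (∫ s, Real.log (laplace P (X 1) (h s * u)) ∂μ)) :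
    ∃ (d' : ℝ) (ν' : Measure ℝ), HasDriftAndLevyMeasure P W d' ν' ∧ bgSet ν' = bgSet ν := by
  have h0' : ∀ᵐ a ∂(μ.map h), 0 ≤ a := (ae_map_iff hm measurableSet_Ici).2 h0
  have hC' : ∀ᵐ a ∂(μ.map h), a ≤ C := (ae_map_iff hm measurableSet_Iic).2 hC
  refine ⟨_, _, hν.of_averaged_exponent (μ.map h) h0' hC'
    fun u hu => ?_, hν.isClockMeasure.bgSet_scaleMeasure (μ.map h) (C := C) ?_ ?_⟩
  · rw [hW u hu, integral_map hm
      (measurable_log_laplace (hX.levy.measurable 1) u).aestronglyMeasurable]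
  · filter_upwards [h0', hC'] with a h0 hC
    rwa [abs_of_nonneg h0]
  · intro hz
    refine hne ?_
    have : ∀ᵐ a ∂(μ.map h), a = 0 := hz
    exact (ae_map_iff hm (measurableSet_singleton (0 : ℝ))).1 this

end Mixture

/-! ### Laplace transforms of linear functionals of the path of a subordinator -/

/-- The smallest point of the grid `ℕ / N` to the right of `s`. -/
def gridCeil (N : ℕ) (s : ℝ) : ℝ≥0 := (⌈s * N⌉₊ : ℝ≥0) / N

lemma monotone_gridCeil (N : ℕ) : Monotone (gridCeil N) := fun s r h => by
  unfold gridCeil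
  gcongr

/-- The grid approximates `s` from the right because paths are only right-continuous. -/
lemma toNNReal_le_gridCeil {N : ℕ} (hN : 0 < N) (s : ℝ) : s.toNNReal ≤ gridCeil N s := by
  have hN' : (0 : ℝ) < N := by exact_mod_cast hN
  rw [Real.toNNReal_le_iff_le_coe, gridCeil]
  push_cast
  rw [le_div_iff₀ hN']
  exact Nat.le_ceil _

lemma ceil_mul_le {N : ℕ} {s : ℝ} (hs : s ≤ 1) : ⌈s * N⌉₊ ≤ N :=
  Nat.ceil_le.2 (mul_le_of_le_one_left (Nat.cast_nonneg N) hs)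

lemma gridCeil_le_one {N : ℕ} {s : ℝ} (hs : s ≤ 1) : gridCeil N s ≤ 1 :=
  div_le_one_of_le₀ (by exact_mod_cast ceil_mul_le hs) zero_le

lemma tendsto_gridCeil {s : ℝ} (hs : 0 ≤ s) :
    Tendsto (fun k : ℕ => gridCeil (k + 1) s) atTop (𝓝 s.toNNReal) := by
  rw [← NNReal.tendsto_coe, Real.coe_toNNReal _ hs]
  have h := (tendsto_nat_ceil_mul_div_atTop hs).comp
    ((tendsto_natCast_atTop_atTop (R := ℝ)).comp (tendsto_add_atTop_nat 1))
  simpa [gridCeil, Function.comp_def] using h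

/-- The mass that `θ` gives to the cells of mesh `1 / N` from the one of `r` onwards. -/
def gridTail (θ : Measure ℝ) (N : ℕ) (r : ℝ) : ℝ := θ.real {s | ⌈r * N⌉₊ ≤ ⌈s * N⌉₊}

lemma monotone_ceil_mul (N : ℕ) : Monotone fun s : ℝ => ⌈s * N⌉₊ := fun s r h => by
  beta_reduce
  gcongr

lemma measurableSet_ceil_ge (N i : ℕ) : MeasurableSet {s : ℝ | i ≤ ⌈s * N⌉₊} :=
  measurableSet_le measurable_const (monotone_ceil_mul N).measurable

lemma antitone_gridTail (θ : Measure ℝ) [IsFiniteMeasure θ] (N : ℕ) :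
    Antitone (gridTail θ N) := fun r r' h =>
  measureReal_mono fun _ hs => (monotone_ceil_mul N h).trans hs

lemma antitone_real_Ici (θ : Measure ℝ) [IsFiniteMeasure θ] :
    Antitone fun r => θ.real (Set.Ici r) := fun _ _ h =>
  measureReal_mono (Set.Ici_subset_Ici.2 h)

/-- Points `s ≥ r` are always counted. A point `s < r` falls in an earlier cell once the mesh is
below `r - s`. -/
lemma tendsto_gridTail {θ : Measure ℝ} [IsFiniteMeasure θ] (hθ : ∀ᵐ s ∂θ, s ∈ Set.Ioc (0 : ℝ) 1)
    (r : ℝ) : Tendsto (fun k : ℕ => gridTail θ (k + 1) r) atTop (𝓝 (θ.real (Set.Ici r))) := by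
  refine (ENNReal.tendsto_toReal (measure_ne_top _ _)).comp
    (tendsto_measure_of_ae_tendsto_indicator_of_isFiniteMeasure atTop measurableSet_Ici
      (fun k => measurableSet_ceil_ge (k + 1) _) ?_)
  filter_upwards [hθ] with s hs
  rcases le_or_gt r s with h | h
  · exact Eventually.of_forall fun k => iff_of_true (monotone_ceil_mul _ h) h
  · obtain ⟨n, hn⟩ := exists_nat_gt (1 / (r - s))
    filter_upwards [eventually_ge_atTop n] with k hk
    refine iff_of_false (fun hle => ?_) (not_le.2 h)
    have hk' : (n : ℝ) ≤ ((k + 1 : ℕ) : ℝ) := by exact_mod_cast hk.trans (Nat.le_succ k)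
    have h1 : 1 < (r - s) * ((k + 1 : ℕ) : ℝ) := by
      rw [div_lt_iff₀ (sub_pos.2 h)] at hn
      nlinarith
    have h2 : (⌈s * ((k + 1 : ℕ) : ℝ)⌉₊ : ℝ) < s * ((k + 1 : ℕ) : ℝ) + 1 :=
      Nat.ceil_lt_add_one (mul_nonneg hs.1.le (Nat.cast_nonneg _))
    have h3 : r * ((k + 1 : ℕ) : ℝ) ≤ (⌈r * ((k + 1 : ℕ) : ℝ)⌉₊ : ℝ) := Nat.le_ceil _
    have h4 : (⌈r * ((k + 1 : ℕ) : ℝ)⌉₊ : ℝ) ≤ (⌈s * ((k + 1 : ℕ) : ℝ)⌉₊ : ℝ) := by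
      exact_mod_cast hle
    nlinarith

/-- Summation by parts for a path sampled on a grid. -/
lemma integral_gridCeil {θ : Measure ℝ} [IsFiniteMeasure θ]
    (hθ : ∀ᵐ s ∂θ, s ∈ Set.Ioc (0 : ℝ) 1) {x : ℝ≥0 → ℝ} (hx0 : x 0 = 0) (N : ℕ) :
    ∫ s, x (gridCeil N s) ∂θ =
      ∑ i ∈ Finset.range N, θ.real {s | i + 1 ≤ ⌈s * N⌉₊} *
        (x (((i + 1 : ℕ) : ℝ≥0) / N) - x ((i : ℝ≥0) / N)) := by
  have h1 : ∀ᵐ s ∂θ, x (gridCeil N s) = ∑ i ∈ Finset.range N,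
      {s : ℝ | i + 1 ≤ ⌈s * N⌉₊}.indicator
        (fun _ : ℝ => x (((i + 1 : ℕ) : ℝ≥0) / N) - x ((i : ℝ≥0) / N)) s := by
    filter_upwards [hθ] with s hs
    have hsum := Finset.sum_range_sub (fun i : ℕ => x ((i : ℝ≥0) / N)) ⌈s * N⌉₊
    simp only [Nat.cast_zero, zero_div, hx0, sub_zero] at hsum
    rw [gridCeil, ← hsum]
    have hsub : Finset.range ⌈s * N⌉₊ ⊆ Finset.range N := by
      rw [Finset.range_subset_range]
      exact ceil_mul_le hs.2
    rw [← Finset.sum_subset hsub]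
    · refine Finset.sum_congr rfl fun i hi => ?_
      rw [Set.indicator_of_mem]
      exact Finset.mem_range.1 hi
    · intro i _ hi
      rw [Set.indicator_of_notMem]
      exact fun h => hi (Finset.mem_range.2 h)
  rw [integral_congr_ae h1, integral_finsetSum _ fun i _ =>
    (integrable_const _).indicator (measurableSet_ceil_ge N (i + 1))]
  refine Finset.sum_congr rfl fun i _ => ?_
  rw [integral_indicator_const _ (measurableSet_ceil_ge N (i + 1)), smul_eq_mul]

/-- A function of the grid cell integrates to its average over the cells. -/
lemma integral_ceil_mul {N : ℕ} (hN : 0 < N) (g : ℕ → ℝ) :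
    ∫ r in (0 : ℝ)..1, g ⌈r * N⌉₊ = ∑ i ∈ Finset.range N, (N : ℝ)⁻¹ * g (i + 1) := by
  have hN' : (0 : ℝ) < N := by exact_mod_cast hN
  have hcell : ∀ i : ℕ, Set.EqOn (fun _ : ℝ => g (i + 1)) (fun r => g ⌈r * N⌉₊)
      (Set.uIoc ((i : ℝ) / N) (((i + 1 : ℕ) : ℝ) / N)) := by
    intro i r hr
    rw [Set.uIoc_of_le (by gcongr; exact Nat.le_succ i), Set.mem_Ioc, div_lt_iff₀ hN',
      le_div_iff₀ hN'] at hr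
    have : ⌈r * N⌉₊ = i + 1 := (Nat.ceil_eq_iff i.succ_ne_zero).2 hr
    simp only [this]
  have hsum := intervalIntegral.sum_integral_adjacent_intervals (μ := volume)
    (f := fun r : ℝ => g ⌈r * N⌉₊) (a := fun i : ℕ => (i : ℝ) / N) (n := N)
    fun i _ => (intervalIntegrable_const (c := g (i + 1))).congr (hcell i)
  simp only [Nat.cast_zero, zero_div, div_self hN'.ne'] at hsum
  rw [← hsum]
  refine Finset.sum_congr rfl fun i _ => ?_
  rw [← intervalIntegral.integral_congr_ae (ae_of_all _ fun r hr => hcell i hr),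
    intervalIntegral.integral_const, smul_eq_mul]
  congr 1
  push_cast
  field_simp
  ring

/-! ### Linear functionals of the path as limits of sums of independent increments -/

section PathFunctional

variable {Ω : Type*} [MeasurableSpace Ω] {P : Measure Ω} [IsProbabilityMeasure P]
  {X : ℝ≥0 → Ω → ℝ}

/-- The increments over the cells are independent with the law of `X_{1/N}`, whose log-transform is
`1/N` times that of `X_1`. -/
lemma IsSubordinator.integral_exp_sum_increments (hX : IsSubordinator P X) {N : ℕ}
    (w : ℕ → ℝ) (hw : ∀ i, 0 ≤ w i) :
    ∫ ω, Real.exp (-∑ i ∈ Finset.range N,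
        w i * (X (((i + 1 : ℕ) : ℝ≥0) / N) ω - X ((i : ℝ≥0) / N) ω)) ∂P =
      Real.exp (∑ i ∈ Finset.range N, (N : ℝ)⁻¹ * Real.log (laplace P (X 1) (w i))) := by
  have hmono : Monotone fun i : ℕ => (i : ℝ≥0) / N := fun i j h => by
    beta_reduce
    gcongr
  have hm := hX.levy.measurable
  have hind := iIndepFun.integral_fun_prod_comp (𝕜 := ℝ)
    (X := fun (i : Fin N) ω => X (((i + 1 : ℕ) : ℝ≥0) / N) ω - X (((i : ℕ) : ℝ≥0) / N) ω)
    (f := fun i x => Real.exp (-(w i * x)))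
    ((hX.levy.indep.nat hmono).precomp (Fin.val_injective (n := N)))
    (fun i => ((hm _).sub (hm _)).aemeasurable) (fun i => by fun_prop)
  rw [Real.exp_sum, Finset.prod_range]
  refine Eq.trans ?_ (hind.trans ?_)
  · refine integral_congr_ae (ae_of_all _ fun ω => ?_)
    simp only
    rw [← Finset.sum_neg_distrib, Real.exp_sum, Finset.prod_range]
  · refine Finset.prod_congr rfl fun i _ => ?_
    rw [hX.levy.laplace_sub (hmono (Nat.le_succ i)), hX.laplace_eq_exp _ (hw i)]
    congr 2
    beta_reduce
    rw [Nat.cast_succ, add_div, add_tsub_cancel_left]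
    simp

lemma IsSubordinator.antitoneOn_laplace (hX : IsSubordinator P X) :
    AntitoneOn (laplace P (X 1)) (Set.Ici 0) := by
  intro u hu v hv huv
  have hX0 := hX.ae_nonneg.mono fun _ h => h 1
  have hXm := (hX.levy.measurable 1).aemeasurable (μ := P)
  refine integral_mono_ae (integrable_exp_neg_mul hXm hX0 hv)
    (integrable_exp_neg_mul hXm hX0 hu) ?_
  filter_upwards [hX0] with ω hω
  gcongr

lemma IsSubordinator.continuousOn_laplace (hX : IsSubordinator P X) :
    ContinuousOn (laplace P (X 1)) (Set.Ici 0) := by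
  have hXm := (hX.levy.measurable 1).aemeasurable (μ := P)
  refine continuousOn_of_dominated (bound := fun _ => 1) (fun u _ => by fun_prop) (fun u hu => ?_)
    (integrable_const _) (ae_of_all _ fun ω => by fun_prop)
  filter_upwards [hX.ae_nonneg] with ω hω
  rw [Real.norm_of_nonneg (Real.exp_pos _).le, Real.exp_le_one_iff]
  have := mul_nonneg (show 0 ≤ u from hu) (hω 1)
  linarith

/-- Supplies the dominating function when the grid tails converge. -/
lemma IsSubordinator.abs_log_laplace_le (hX : IsSubordinator P X) {u v : ℝ} (hu : 0 ≤ u)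
    (huv : u ≤ v) : |Real.log (laplace P (X 1) u)| ≤ |Real.log (laplace P (X 1) v)| := by
  have h1 := Real.log_nonpos (hX.laplace_pos 1 hu).le (hX.laplace_le_one 1 hu)
  have h2 := Real.log_le_log (hX.laplace_pos 1 (hu.trans huv))
    (hX.antitoneOn_laplace hu (hu.trans huv : (0 : ℝ) ≤ v) huv)
  rw [abs_of_nonpos h1, abs_of_nonpos (h2.trans h1)]
  linarith

lemma continuousWithinAt_tendsto_gridCeil {x : ℝ≥0 → ℝ}
    (hx : ∀ t, ContinuousWithinAt x (Set.Ici t) t) {s : ℝ} (hs : 0 ≤ s) :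
    Tendsto (fun k : ℕ => x (gridCeil (k + 1) s)) atTop (𝓝 (x s.toNNReal)) := by
  refine (hx s.toNNReal).tendsto.comp (tendsto_nhdsWithin_iff.2 ⟨tendsto_gridCeil hs, ?_⟩)
  exact Eventually.of_forall fun k => toNNReal_le_gridCeil k.succ_pos s

lemma tendsto_integral_gridCeil {θ : Measure ℝ} [IsFiniteMeasure θ]
    (hθ : ∀ᵐ s ∂θ, s ∈ Set.Ioc (0 : ℝ) 1) {x : ℝ≥0 → ℝ} (hmono : Monotone x) (h0 : x 0 = 0)
    (hx : ∀ t, ContinuousWithinAt x (Set.Ici t) t) :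
    Tendsto (fun k : ℕ => ∫ s, x (gridCeil (k + 1) s) ∂θ) atTop
      (𝓝 (∫ s, x s.toNNReal ∂θ)) := by
  refine tendsto_integral_of_dominated_convergence (fun _ => x 1)
    (fun k => (hmono.comp (monotone_gridCeil (k + 1))).measurable.aestronglyMeasurable)
    (integrable_const _) (fun k => ?_) ?_
  · filter_upwards [hθ] with s hs
    rw [Real.norm_of_nonneg (h0 ▸ hmono zero_le)]
    exact hmono (gridCeil_le_one hs.2)
  · filter_upwards [hθ] with s hs
    exact continuousWithinAt_tendsto_gridCeil hx hs.1.le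

/-- The Laplace transform of a linear functional of the path of a subordinator. -/
theorem IsSubordinator.laplace_integral_path (hX : IsSubordinator P X) (θ : Measure ℝ)
    [IsFiniteMeasure θ] (hθ : ∀ᵐ s ∂θ, s ∈ Set.Ioc (0 : ℝ) 1) {u : ℝ} (hu : 0 ≤ u) :
    laplace P (fun ω => ∫ s, X s.toNNReal ω ∂θ) u =
      Real.exp (∫ r in (0 : ℝ)..1, Real.log (laplace P (X 1) (θ.real (Set.Ici r) * u))) := by
  -- Almost surely `u` times the integral of the path sampled on the grid of mesh `1 / (k + 1)`,
  -- written through increments with the tails of `θ` as weights.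
  let A : ℕ → Ω → ℝ := fun k ω => ∑ i ∈ Finset.range (k + 1),
    θ.real {s | i + 1 ≤ ⌈s * ((k + 1 : ℕ) : ℝ)⌉₊} * u *
      (X (((i + 1 : ℕ) : ℝ≥0) / (k + 1 : ℕ)) ω - X ((i : ℝ≥0) / (k + 1 : ℕ)) ω)
  have hA : ∀ᵐ ω ∂P, ∀ k, A k ω = u * ∫ s, X (gridCeil (k + 1) s) ω ∂θ := by
    filter_upwards [hX.levy.zero] with ω h0 k
    rw [integral_gridCeil hθ (x := fun t => X t ω) h0, Finset.mul_sum]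
    exact Finset.sum_congr rfl fun i _ => by ring
  have hAm : ∀ k, Measurable (A k) := fun k =>
    Finset.measurable_fun_sum _ fun i _ =>
      ((hX.levy.measurable _).sub (hX.levy.measurable _)).const_mul _
  have hleft : Tendsto (fun k => ∫ ω, Real.exp (-A k ω) ∂P) atTop
      (𝓝 (laplace P (fun ω => ∫ s, X s.toNNReal ω ∂θ) u)) := by
    refine tendsto_integral_of_dominated_convergence (fun _ => 1)
      (fun k => (hAm k).neg.exp.aestronglyMeasurable) (integrable_const _) (fun k => ?_) ?_
    · filter_upwards [hA, hX.ae_nonneg] with ω h1 h2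
      rw [Real.norm_of_nonneg (Real.exp_pos _).le, Real.exp_le_one_iff, h1, neg_nonpos]
      exact mul_nonneg hu (integral_nonneg fun s => h2 _)
    · filter_upwards [hA, hX.levy.zero, hX.mono, hX.levy.cadlag] with ω h1 h0 hm hc
      simp only [h1]
      exact (Real.continuous_exp.tendsto _).comp
        ((tendsto_integral_gridCeil hθ hm h0 fun t => (hc t).1).const_mul u).neg
  have hfin : ∀ k, ∫ ω, Real.exp (-A k ω) ∂P =
      Real.exp (∫ r in (0 : ℝ)..1, Real.log (laplace P (X 1) (gridTail θ (k + 1) r * u))) := by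
    intro k
    rw [hX.integral_exp_sum_increments
      (fun i => θ.real {s | i + 1 ≤ ⌈s * ((k + 1 : ℕ) : ℝ)⌉₊} * u)
      fun i => mul_nonneg measureReal_nonneg hu,
      ← integral_ceil_mul k.succ_pos fun i => Real.log (laplace P (X 1)
        (θ.real {s | i ≤ ⌈s * ((k + 1 : ℕ) : ℝ)⌉₊} * u))]
    rfl
  have hright : Tendsto (fun k : ℕ => Real.exp (∫ r in (0 : ℝ)..1,
      Real.log (laplace P (X 1) (gridTail θ (k + 1) r * u)))) atTop
      (𝓝 (Real.exp (∫ r in (0 : ℝ)..1,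
        Real.log (laplace P (X 1) (θ.real (Set.Ici r) * u))))) := by
    refine (Real.continuous_exp.tendsto _).comp ?_
    refine intervalIntegral.tendsto_integral_filter_of_dominated_convergence
      -- Every tail is at most the total mass of `θ`, which gives a constant bound.
      (fun _ => |Real.log (laplace P (X 1) (θ.real Set.univ * u))|) ?_ ?_
      intervalIntegrable_const ?_
    · exact Eventually.of_forall fun k => ((measurable_log_laplace (hX.levy.measurable 1) u).comp
        (antitone_gridTail θ (k + 1)).measurable).aestronglyMeasurable
    · refine Eventually.of_forall fun k => ae_of_all _ fun r _ => ?_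
      exact hX.abs_log_laplace_le (mul_nonneg measureReal_nonneg hu)
        (mul_le_mul_of_nonneg_right (measureReal_mono (Set.subset_univ _)) hu)
    · refine ae_of_all _ fun r _ => ?_
      have hpos : 0 ≤ θ.real (Set.Ici r) * u := mul_nonneg measureReal_nonneg hu
      refine (Real.continuousAt_log (hX.laplace_pos 1 hpos).ne').tendsto.comp ?_
      refine (hX.continuousOn_laplace _ hpos).tendsto.comp (tendsto_nhdsWithin_iff.2
        ⟨(tendsto_gridTail hθ r).mul_const u, ?_⟩)
      exact Eventually.of_forall fun k => mul_nonneg measureReal_nonneg hu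
  exact tendsto_nhds_unique (hleft.congr hfin) hright

end PathFunctional

/-! ### Averaging kernels -/

/-- A nonzero finite measure on `(0, 1]`. -/
structure IsKernel (θ : Measure ℝ) : Prop where
  finite : IsFiniteMeasure θ
  ae_mem : ∀ᵐ s ∂θ, s ∈ Set.Ioc (0 : ℝ) 1
  ne_zero : θ ≠ 0

/-- The measure `v^a dv` on `(0, 1]`. -/
def powKernel (a : ℕ) : Measure ℝ :=
  (volume.restrict (Set.Ioc (0 : ℝ) 1)).withDensity fun v => ENNReal.ofReal (v ^ a)

/-- The image of `v^a dv ⊗ θ` under multiplication. -/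
def nextKernel (a : ℕ) (θ : Measure ℝ) : Measure ℝ :=
  ((powKernel a).prod θ).map fun q => q.1 * q.2

lemma isKernel_dirac_one : IsKernel (Measure.dirac 1) :=
  ⟨inferInstance, (ae_dirac_iff measurableSet_Ioc).2 (by simp), NeZero.ne _⟩

lemma isKernel_powKernel (a : ℕ) : IsKernel (powKernel a) := by
  have hint : Integrable (fun v : ℝ => v ^ a) (volume.restrict (Set.Ioc (0 : ℝ) 1)) := by
    refine Integrable.of_bound (by fun_prop) 1 ?_
    filter_upwards [ae_restrict_mem measurableSet_Ioc] with v hv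
    rw [Real.norm_of_nonneg (pow_nonneg hv.1.le a)]
    exact pow_le_one₀ hv.1.le hv.2
  refine ⟨isFiniteMeasure_withDensity_ofReal hint.2,
    withDensity_absolutelyContinuous _ _ (ae_restrict_mem measurableSet_Ioc), fun h => ?_⟩
  rw [powKernel, withDensity_eq_zero_iff (by fun_prop)] at h
  have hfalse : ∀ᵐ v ∂(volume.restrict (Set.Ioc (0 : ℝ) 1)), False := by
    filter_upwards [h, ae_restrict_mem measurableSet_Ioc] with v hv hmem
    rw [Pi.zero_apply, ENNReal.ofReal_eq_zero] at hv
    exact absurd (pow_pos hmem.1 a) (not_lt.2 hv)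
  rw [eventually_false_iff_eq_bot, ae_eq_bot, Measure.restrict_eq_zero, Real.volume_Ioc] at hfalse
  simp at hfalse

lemma IsKernel.next {θ : Measure ℝ} (hθ : IsKernel θ) (a : ℕ) : IsKernel (nextKernel a θ) := by
  have := hθ.finite
  have hp := isKernel_powKernel a
  have := hp.finite
  have hmul : Measurable fun q : ℝ × ℝ => q.1 * q.2 := by fun_prop
  refine ⟨by unfold nextKernel; infer_instance, ?_, fun h => ?_⟩
  · refine (ae_map_iff hmul.aemeasurable measurableSet_Ioc).2 ?_
    change ∀ᵐ q ∂((powKernel a).prod θ), q ∈ (fun q : ℝ × ℝ => q.1 * q.2) ⁻¹' Set.Ioc 0 1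
    rw [Measure.ae_prod_mem_iff_ae_ae_mem (hmul measurableSet_Ioc)]
    filter_upwards [hp.ae_mem] with v hv
    filter_upwards [hθ.ae_mem] with s hs
    exact ⟨mul_pos hv.1 hs.1, mul_le_one₀ hv.2 hs.1.le hs.2⟩
  · rw [nextKernel, Measure.map_eq_zero_iff hmul.aemeasurable,
      ← Measure.measure_univ_eq_zero, ← Set.univ_prod_univ, Measure.prod_prod, mul_eq_zero,
      Measure.measure_univ_eq_zero, Measure.measure_univ_eq_zero] at h
    exact h.elim hp.ne_zero hθ.ne_zero

/-- The functional `∫ x(t s) θ(ds)` of a path. -/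
def pathAverage (θ : Measure ℝ) (x : ℝ≥0 → ℝ) (t : ℝ≥0) : ℝ := ∫ s, x (t * s.toNNReal) ∂θ

lemma pathAverage_dirac_one (x : ℝ≥0 → ℝ) (t : ℝ≥0) : pathAverage (Measure.dirac 1) x t = x t := by
  simp [pathAverage]

lemma monotone_comp_mul_toNNReal {x : ℝ≥0 → ℝ} (hx : Monotone x) (t : ℝ≥0) :
    Monotone fun s : ℝ => x (t * s.toNNReal) := fun _ _ h =>
  hx (mul_le_mul_right (Real.toNNReal_mono h) t)

/-- Fubini, with the integrand bounded by `x t` because the path is monotone from `0` and the kernel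
lives on `(0, 1]`. -/
lemma pathAverage_nextKernel {θ : Measure ℝ} (hθ : IsKernel θ) (a : ℕ) {x : ℝ≥0 → ℝ}
    (hx : Monotone x) (h0 : x 0 = 0) (t : ℝ≥0) :
    pathAverage (nextKernel a θ) x t =
      ∫ v in (0 : ℝ)..1, v ^ a * pathAverage θ x (t * v.toNNReal) := by
  have := hθ.finite
  have := (isKernel_powKernel a).finite
  have hm := (monotone_comp_mul_toNNReal hx t).measurable
  have hmul : Measurable fun q : ℝ × ℝ => q.1 * q.2 := by fun_prop
  have hmem : ∀ᵐ s ∂(nextKernel a θ), s ∈ Set.Ioc (0 : ℝ) 1 := (hθ.next a).ae_mem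
  have hfin := (hθ.next a).finite
  have hint : Integrable (fun s : ℝ => x (t * s.toNNReal)) (nextKernel a θ) := by
    refine Integrable.of_bound hm.aestronglyMeasurable (x t) ?_
    filter_upwards [hmem] with s hs
    rw [Real.norm_of_nonneg (h0 ▸ hx zero_le)]
    exact hx (mul_le_of_le_one_right zero_le (Real.toNNReal_le_one.2 hs.2))
  have hint' : Integrable (fun q : ℝ × ℝ => x (t * (q.1 * q.2).toNNReal))
      ((powKernel a).prod θ) :=
    (integrable_map_measure hm.aestronglyMeasurable hmul.aemeasurable).1 hint
  rw [pathAverage, nextKernel, integral_map hmul.aemeasurable hm.aestronglyMeasurable,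
    integral_prod _ hint', powKernel, integral_withDensity_eq_integral_toReal_smul (by fun_prop)
      (ae_of_all _ fun _ => ENNReal.ofReal_lt_top),
    intervalIntegral.integral_of_le zero_le_one]
  refine setIntegral_congr_fun measurableSet_Ioc fun v hv => ?_
  simp only [pathAverage, smul_eq_mul]
  rw [ENNReal.toReal_ofReal (pow_nonneg hv.1.le a)]
  congr 1
  refine integral_congr_ae (ae_of_all _ fun s => ?_)
  simp only
  rw [Real.toNNReal_mul hv.1.le, mul_assoc]

/-- The substitution `r = t v` pulls out `t ^ (a + 1)`. Running averages use `a = 0`; the cumulation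
of a `k`-fold cumulation uses `a = k`, since the latter already carries `t ^ k`. -/
lemma integral_pow_mul_pathAverage {θ : Measure ℝ} (hθ : IsKernel θ) (a : ℕ) {x : ℝ≥0 → ℝ}
    (hx : Monotone x) (h0 : x 0 = 0) (t : ℝ≥0) :
    ∫ r in (0 : ℝ)..t, r ^ a * pathAverage θ x r.toNNReal =
      (t : ℝ) ^ (a + 1) * pathAverage (nextKernel a θ) x t := by
  have h := intervalIntegral.mul_integral_comp_mul_left (a := 0) (b := 1)
    (f := fun r : ℝ => r ^ a * pathAverage θ x r.toNNReal) (t : ℝ)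
  rw [mul_zero, mul_one] at h
  rw [← h, pathAverage_nextKernel hθ a hx h0, pow_succ', mul_assoc,
    ← intervalIntegral.integral_const_mul ((t : ℝ) ^ a)]
  congr 1
  refine intervalIntegral.integral_congr fun v _ => ?_
  rw [Real.toNNReal_mul t.coe_nonneg, Real.toNNReal_coe, mul_pow, mul_assoc]

/-- The recipe commutes with rescaling of time, so one kernel serves every path and every `t`. -/
lemma exists_kernel_averageI (k : ℕ) : ∃ θ : Measure ℝ, IsKernel θ ∧
    ∀ {Ω : Type*} {X : ℝ≥0 → Ω → ℝ} {ω : Ω}, Monotone (fun t => X t ω) → X 0 ω = 0 →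
      ∀ t, averageI X k t ω = pathAverage θ (fun t => X t ω) t := by
  induction k with
  | zero =>
    refine ⟨_, isKernel_dirac_one, fun _ _ t => ?_⟩
    rw [pathAverage_dirac_one]
    rfl
  | succ k ih =>
    obtain ⟨θ, hθ, h⟩ := ih
    refine ⟨_, hθ.next 0, fun {Ω X ω} hm h0 t => ?_⟩
    have hstep := integral_pow_mul_pathAverage hθ 0 hm h0 t
    simp only [pow_zero, one_mul, zero_add, pow_one] at hstep
    rw [averageI, Function.iterate_succ_apply', ← averageI, runningAverage, cumulation,
      intervalIntegral.integral_congr (g := fun r : ℝ =>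
      pathAverage θ (fun t => X t ω) r.toNNReal) fun r _ => h hm h0 r.toNNReal, hstep]
    -- At `t = 0` the left side vanishes by the convention `0⁻¹ = 0`, and the right side because the
    -- path starts at `0`.
    by_cases ht : t = 0
    · subst ht
      simp [pathAverage, h0]
    · rw [inv_mul_cancel_left₀ (by exact_mod_cast ht)]

lemma exists_kernel_cumulation (k : ℕ) : ∃ θ : Measure ℝ, IsKernel θ ∧
    ∀ {Ω : Type*} {X : ℝ≥0 → Ω → ℝ} {ω : Ω}, Monotone (fun t => X t ω) → X 0 ω = 0 →
      ∀ t, (cumulation^[k] X) t ω = (t : ℝ) ^ k * pathAverage θ (fun t => X t ω) t := by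
  induction k with
  | zero =>
    refine ⟨_, isKernel_dirac_one, fun _ _ t => ?_⟩
    rw [pathAverage_dirac_one, pow_zero, one_mul, Function.iterate_zero, id]
  | succ k ih =>
    obtain ⟨θ, hθ, h⟩ := ih
    refine ⟨_, hθ.next k, fun {Ω X ω} hm h0 t => ?_⟩
    rw [← integral_pow_mul_pathAverage hθ k hm h0 t, Function.iterate_succ_apply', cumulation]
    refine intervalIntegral.integral_congr fun r hr => ?_
    rw [Set.uIcc_of_le t.coe_nonneg] at hr
    rw [h hm h0, Real.coe_toNNReal _ hr.1]

/-- Tails vanishing almost everywhere would vanish at points arbitrarily close to `0`, leaving `θ`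
no mass on `(0, ∞)`. Hence the factors for `θ` are not almost surely zero. -/
lemma IsKernel.not_ae_real_Ici_eq_zero {θ : Measure ℝ} (hθ : IsKernel θ) :
    ¬ ∀ᵐ r ∂(volume.restrict (Set.Ioc (0 : ℝ) 1)), θ.real (Set.Ici r) = 0 := by
  have := hθ.finite
  intro h
  refine hθ.ne_zero (Measure.measure_univ_eq_zero.1 ?_)
  have hIoi : θ (Set.Ioi 0) = 0 := by
    rw [← iUnion_Ici_eq_Ioi_of_lt_of_tendsto (a := (0 : ℝ))
      (f := fun n : ℕ => 1 / ((n : ℝ) + 1)) (fun n => by positivity)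
      tendsto_one_div_add_atTop_nhds_zero_nat]
    refine measure_iUnion_null fun n => ?_
    have hn : (0 : ℝ) < 1 / ((n : ℝ) + 1) := by positivity
    have hn1 : 1 / ((n : ℝ) + 1) ≤ 1 := by
      rw [div_le_one (by positivity)]
      linarith [Nat.cast_nonneg (α := ℝ) n]
    have hsub := ae_mono (Measure.restrict_mono_set volume
      (Set.Ioc_subset_Ioc_right hn1 : Set.Ioc (0 : ℝ) _ ⊆ Set.Ioc 0 1)) h
    have hne : (ae (volume.restrict (Set.Ioc (0 : ℝ) (1 / ((n : ℝ) + 1))))).NeBot := by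
      rw [ae_neBot, ne_eq, Measure.restrict_eq_zero, Real.volume_Ioc]
      simpa using hn
    obtain ⟨r, hr0, hr⟩ := (Filter.Eventually.and hsub
      (ae_restrict_mem measurableSet_Ioc)).exists
    exact measure_mono_null (Set.Ici_subset_Ici.2 hr.2) ((measureReal_eq_zero_iff).1 hr0)
  have hcompl : θ (Set.Ioi 0)ᶜ = 0 := hθ.ae_mem.mono fun s hs => hs.1
  rw [← Set.union_compl_self (Set.Ioi (0 : ℝ))]
  exact measure_union_null hIoi hcompl

/-! ### Integer degrees: clocks induced by averaging -/

section Recipes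

variable {Ω : Type*} [MeasurableSpace Ω] {P : Measure Ω} [IsProbabilityMeasure P]
  {X W : ℝ≥0 → Ω → ℝ} {d : ℝ} {ν : Measure ℝ}

/-- A process with the time-one law of an averaged path of `X` has the Blumenthal–Getoor exponents
of `X`. -/
theorem exists_driftAndLevyMeasure_of_pathAverage (hX : IsSubordinator P X)
    (hν : HasDriftAndLevyMeasure P X d ν) {θ : Measure ℝ} (hθ : IsKernel θ) {A : Ω → ℝ}
    (hA : ∀ᵐ ω ∂P, A ω = pathAverage θ (fun t => X t ω) 1) (hW : IdentDistrib (W 1) A P P) :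
    ∃ (d' : ℝ) (ν' : Measure ℝ), HasDriftAndLevyMeasure P W d' ν' ∧ bgSet ν' = bgSet ν := by
  have := hθ.finite
  refine exists_driftAndLevyMeasure_of_laplace hX hν (volume.restrict (Set.Ioc (0 : ℝ) 1))
    (antitone_real_Ici θ).measurable.aemeasurable (C := θ.real Set.univ)
    (ae_of_all _ fun _ => measureReal_nonneg)
    (ae_of_all _ fun _ => measureReal_mono (Set.subset_univ _)) hθ.not_ae_real_Ici_eq_zero
    fun u hu => ?_
  rw [← intervalIntegral.integral_of_le zero_le_one, ← hX.laplace_integral_path θ hθ.ae_mem hu]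
  refine ((hW.comp (u := fun x : ℝ => Real.exp (-(u * x))) (by fun_prop)).integral_eq).trans ?_
  refine integral_congr_ae ?_
  filter_upwards [hA] with ω hω
  simp only [Function.comp_apply, hω, pathAverage, one_mul]

lemma RecipeI.exists_driftAndLevyMeasure (hX : IsSubordinator P X)
    (hν : HasDriftAndLevyMeasure P X d ν) {k : ℕ} (hW : RecipeI P X k W) :
    ∃ (d' : ℝ) (ν' : Measure ℝ), HasDriftAndLevyMeasure P W d' ν' ∧ bgSet ν' = bgSet ν := by
  obtain ⟨θ, hθ, h⟩ := exists_kernel_averageI k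
  refine exists_driftAndLevyMeasure_of_pathAverage hX hν hθ ?_ (hW 1)
  filter_upwards [hX.mono, hX.levy.zero] with ω hm h0 using h hm h0 1

lemma RecipeIII.exists_driftAndLevyMeasure (hX : IsSubordinator P X)
    (hν : HasDriftAndLevyMeasure P X d ν) {k : ℕ} (hW : RecipeIII P X k W) :
    ∃ (d' : ℝ) (ν' : Measure ℝ), HasDriftAndLevyMeasure P W d' ν' ∧ bgSet ν' = bgSet ν := by
  obtain ⟨θ, hθ, h⟩ := exists_kernel_cumulation k
  refine exists_driftAndLevyMeasure_of_pathAverage hX hν hθ ?_ (hW 1)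
  filter_upwards [hX.mono, hX.levy.zero] with ω hm h0
  rw [averageIII, h hm h0]
  simp

/-- Each stage is a first-recipe clock of degree one over the previous stage, which is again a
subordinator with known drift and Lévy measure; hence induction along the chain. -/
lemma RecipeII.exists_driftAndLevyMeasure (hX : IsSubordinator P X)
    (hν : HasDriftAndLevyMeasure P X d ν) {k : ℕ} (hW : RecipeII P X k W) :
    ∃ (d' : ℝ) (ν' : Measure ℝ), HasDriftAndLevyMeasure P W d' ν' ∧ bgSet ν' = bgSet ν := by
  obtain ⟨Y, hY0, hYk, hY⟩ := hW
  have key : ∀ j ≤ k, IsSubordinator P (Y j) ∧ ∃ (d' : ℝ) (ν' : Measure ℝ),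
      HasDriftAndLevyMeasure P (Y j) d' ν' ∧ bgSet ν' = bgSet ν := by
    intro j
    induction j with
    | zero => exact fun _ => hY0.symm ▸ ⟨hX, d, ν, hν, rfl⟩
    | succ j ih =>
      intro hj
      obtain ⟨hsub, d', ν', hν', hbg⟩ := ih (Nat.le_of_succ_le hj)
      obtain ⟨hsub', hlaw⟩ := hY j hj
      have hrec : RecipeI P (Y j) 1 (Y (j + 1)) := hlaw
      obtain ⟨d'', ν'', h1, h2⟩ := hrec.exists_driftAndLevyMeasure hsub hν'
      exact ⟨hsub', d'', ν'', h1, h2.trans hbg⟩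
  exact hYk ▸ (key k le_rfl).2

end Recipes

/-! ### Clocks of real degree -/

section RealDegree

lemma integrableOn_gamma_integrand {n : ℝ} (hn : 0 < n) :
    IntegrableOn (fun y : ℝ => y ^ (n - 1) * Real.exp (-y)) (Set.Ioi 0) :=
  (Real.GammaIntegral_convergent hn).congr_fun (fun _ _ => mul_comm _ _) measurableSet_Ioi

lemma gamma_integrand_nonneg {n x : ℝ} (hx : 0 ≤ x) :
    0 ≤ᵐ[volume.restrict (Set.Ioi x)] fun y : ℝ => y ^ (n - 1) * Real.exp (-y) := by
  filter_upwards [ae_restrict_mem measurableSet_Ioi] with y hy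
  exact mul_nonneg (Real.rpow_nonneg (hx.trans (le_of_lt hy)) _) (Real.exp_pos _).le

lemma upperGamma_zero {n : ℝ} (hn : 0 < n) : upperGamma n 0 = Real.Gamma n := by
  rw [upperGamma, Real.Gamma_eq_integral hn]
  exact setIntegral_congr_fun measurableSet_Ioi fun y _ => mul_comm _ _

lemma upperGamma_nonneg (n : ℝ) {x : ℝ} (hx : 0 ≤ x) : 0 ≤ upperGamma n x :=
  integral_nonneg_of_ae (gamma_integrand_nonneg hx)

lemma upperGamma_le_of_le {n : ℝ} (hn : 0 < n) {x y : ℝ} (hx : 0 ≤ x) (hxy : x ≤ y) :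
    upperGamma n y ≤ upperGamma n x :=
  setIntegral_mono_set ((integrableOn_gamma_integrand hn).mono_set (Set.Ioi_subset_Ioi hx))
    (gamma_integrand_nonneg hx) (Set.Ioi_subset_Ioi hxy).eventuallyLE

/-- The integrand is strictly positive on `(0, x)`. Strictness keeps the type-I factors nonzero for
`s < 1`. -/
lemma upperGamma_lt_Gamma {n : ℝ} (hn : 0 < n) {x : ℝ} (hx : 0 < x) :
    upperGamma n x < Real.Gamma n := by
  have hint := integrableOn_gamma_integrand hn
  have hii : IntervalIntegrable (fun y : ℝ => y ^ (n - 1) * Real.exp (-y)) volume 0 x :=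
    (intervalIntegrable_iff_integrableOn_Ioc_of_le hx.le).2
      (hint.mono_set fun y hy => hy.1)
  have hpos := intervalIntegral.intervalIntegral_pos_of_pos_on hii
    (fun y hy => mul_pos (Real.rpow_pos_of_pos hy.1 _) (Real.exp_pos _)) hx
  have hsplit := intervalIntegral.integral_interval_add_Ioi hint
    (hint.mono_set (Set.Ioi_subset_Ioi hx.le))
  rw [← upperGamma_zero hn]
  unfold upperGamma
  linarith

/-- Endpoints are discarded because the type-I factor vanishes at `s = 1`, where `log s = 0`. -/
lemma not_ae_restrict_Ioc_of_forall_Ioo {p : ℝ → Prop} (hp : ∀ s ∈ Set.Ioo (0 : ℝ) 1, ¬ p s) :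
    ¬ ∀ᵐ s ∂(volume.restrict (Set.Ioc (0 : ℝ) 1)), p s := by
  intro h
  rw [← restrict_Ioo_eq_restrict_Ioc] at h
  have hne : (ae (volume.restrict (Set.Ioo (0 : ℝ) 1))).NeBot := by
    rw [ae_neBot, ne_eq, Measure.restrict_eq_zero, Real.volume_Ioo]
    simp
  obtain ⟨s, h1, h2⟩ := (h.and (ae_restrict_mem measurableSet_Ioo)).exists
  exact hp s h2 h1

variable {Ω : Type*} [MeasurableSpace Ω] {P : Measure Ω} [IsProbabilityMeasure P]
  {X W : ℝ≥0 → Ω → ℝ} {d : ℝ} {ν : Measure ℝ} {n : ℝ}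

/-- The factor decreases in `s`, which gives its measurability, and stays in `[0, 1]`; `η` is its
image of Lebesgue measure on `(0, 1]`. -/
lemma LaplaceI.exists_driftAndLevyMeasure (hX : IsSubordinator P X)
    (hν : HasDriftAndLevyMeasure P X d ν) (hn : 0 < n) (hW : LaplaceI P X n W) :
    ∃ (d' : ℝ) (ν' : Measure ℝ), HasDriftAndLevyMeasure P W d' ν' ∧ bgSet ν' = bgSet ν := by
  have hΓ := Real.Gamma_pos_of_pos hn
  have hlog : ∀ s ∈ Set.Ioc (0 : ℝ) 1, 0 ≤ -Real.log s := fun s hs =>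
    neg_nonneg.2 (Real.log_nonpos hs.1.le hs.2)
  have hanti : AntitoneOn (fun s => 1 - upperGamma n (-Real.log s) / Real.Gamma n)
      (Set.Ioc (0 : ℝ) 1) := by
    intro s hs r hr hsr
    have h := upperGamma_le_of_le hn (hlog r hr) (neg_le_neg (Real.log_le_log hs.1 hsr))
    beta_reduce
    gcongr
  refine exists_driftAndLevyMeasure_of_laplace hX hν (volume.restrict (Set.Ioc (0 : ℝ) 1))
    (aemeasurable_restrict_of_antitoneOn measurableSet_Ioc hanti) (C := 1) ?_ ?_
    (not_ae_restrict_Ioc_of_forall_Ioo fun s hs h => ?_) fun u hu => ?_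
  · filter_upwards [ae_restrict_mem measurableSet_Ioc] with s hs
    rw [sub_nonneg, div_le_one hΓ, ← upperGamma_zero hn]
    exact upperGamma_le_of_le hn le_rfl (hlog s hs)
  · filter_upwards [ae_restrict_mem measurableSet_Ioc] with s hs
    have := div_nonneg (upperGamma_nonneg n (hlog s hs)) hΓ.le
    linarith
  · have := upperGamma_lt_Gamma hn (neg_pos.2 (Real.log_neg hs.1 hs.2))
    rw [← div_lt_one hΓ] at this
    linarith
  · rw [hW 1 u hu, NNReal.coe_one, one_mul, intervalIntegral.integral_of_le zero_le_one]

/-- The substitution `v = e^{-y}` turns this into the Gamma integral. -/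
lemma integrableOn_neg_log_rpow (hn : 0 < n) :
    IntegrableOn (fun v : ℝ => (-Real.log v) ^ (n - 1)) (Set.Ioc 0 1) := by
  have himage : (fun y : ℝ => Real.exp (-y)) '' Set.Ioi 0 = Set.Ioo 0 1 := by
    ext v
    constructor
    · rintro ⟨y, hy, rfl⟩
      exact ⟨Real.exp_pos _, Real.exp_lt_one_iff.2 (neg_lt_zero.2 hy)⟩
    · intro hv
      refine ⟨-Real.log v, neg_pos.2 (Real.log_neg hv.1 hv.2), ?_⟩
      simp only [neg_neg]
      exact Real.exp_log hv.1
  rw [integrableOn_Ioc_iff_integrableOn_Ioo, ← himage,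
    integrableOn_image_iff_integrableOn_abs_deriv_smul measurableSet_Ioi
      (f' := fun y => -Real.exp (-y)) (fun y _ => by
        simpa using ((hasDerivAt_id y).neg.exp).hasDerivWithinAt)
      (fun y _ z _ h => by simpa using h)]
  refine (Real.GammaIntegral_convergent hn).congr_fun (fun y _ => ?_) measurableSet_Ioi
  simp

/-- Here the factor is `v` itself and the degree enters through the density `(-log v)^{n-1} / Γ(n)`,
which may be unbounded but is integrable. -/
lemma LaplaceII.exists_driftAndLevyMeasure (hX : IsSubordinator P X)
    (hν : HasDriftAndLevyMeasure P X d ν) (hn : 0 < n) (hW : LaplaceII P X n W) :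
    ∃ (d' : ℝ) (ν' : Measure ℝ), HasDriftAndLevyMeasure P W d' ν' ∧ bgSet ν' = bgSet ν := by
  have hΓ := Real.Gamma_pos_of_pos hn
  let g : ℝ → ℝ := fun v => (-Real.log v) ^ (n - 1) / Real.Gamma n
  have hgm : Measurable g := ((Real.measurable_log.neg).pow_const (n - 1)).div_const _
  have hgi : Integrable g (volume.restrict (Set.Ioc 0 1)) :=
    (integrableOn_neg_log_rpow hn).div_const _
  have hfin := isFiniteMeasure_withDensity_ofReal hgi.2
  have hmem : ∀ᵐ v ∂((volume.restrict (Set.Ioc (0 : ℝ) 1)).withDensity fun v =>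
      ENNReal.ofReal (g v)), v ∈ Set.Ioc (0 : ℝ) 1 :=
    withDensity_absolutelyContinuous _ _ (ae_restrict_mem measurableSet_Ioc)
  refine exists_driftAndLevyMeasure_of_laplace hX hν
    ((volume.restrict (Set.Ioc (0 : ℝ) 1)).withDensity fun v => ENNReal.ofReal (g v))
    aemeasurable_id (C := 1) (hmem.mono fun v hv => hv.1.le) (hmem.mono fun v hv => hv.2)
    (fun h => ?_) fun u hu => ?_
  · rw [ae_withDensity_iff hgm.ennreal_ofReal] at h
    refine not_ae_restrict_Ioc_of_forall_Ioo (fun s hs hs' => ?_) h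
    have hpos : 0 < g s :=
      div_pos (Real.rpow_pos_of_pos (neg_pos.2 (Real.log_neg hs.1 hs.2)) _) hΓ
    exact hs.1.ne' (hs' (ENNReal.ofReal_pos.2 hpos).ne')
  · rw [hW 1 u hu, NNReal.coe_one, integral_withDensity_eq_integral_toReal_smul
      hgm.ennreal_ofReal (ae_of_all _ fun _ => ENNReal.ofReal_lt_top),
      intervalIntegral.integral_of_le zero_le_one, ← integral_const_mul]
    congr 1
    refine setIntegral_congr_fun measurableSet_Ioc fun v hv => ?_
    have hg0 : 0 ≤ g v :=
      div_nonneg (Real.rpow_nonneg (neg_nonneg.2 (Real.log_nonpos hv.1.le hv.2)) _) hΓ.le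
    simp only [id, smul_eq_mul]
    rw [ENNReal.toReal_ofReal hg0, mul_comm u v]
    simp only [g]
    ring

lemma LaplaceIII.exists_driftAndLevyMeasure (hX : IsSubordinator P X)
    (hν : HasDriftAndLevyMeasure P X d ν) (hn : 0 < n) (hW : LaplaceIII P X n W) :
    ∃ (d' : ℝ) (ν' : Measure ℝ), HasDriftAndLevyMeasure P W d' ν' ∧ bgSet ν' = bgSet ν := by
  have hΓ := Real.Gamma_pos_of_pos (show 0 < n + 1 by linarith)
  refine exists_driftAndLevyMeasure_of_laplace hX hν (volume.restrict (Set.Ioc (0 : ℝ) 1))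
    -- The bound is not `1`, since `Γ(n + 1) < 1` for `0 < n < 1`.
    (h := fun s => s ^ n / Real.Gamma (n + 1)) (by fun_prop) (C := 1 / Real.Gamma (n + 1)) ?_ ?_
    (not_ae_restrict_Ioc_of_forall_Ioo fun s hs => ?_) fun u hu => ?_
  · filter_upwards [ae_restrict_mem measurableSet_Ioc] with s hs
    exact div_nonneg (Real.rpow_nonneg hs.1.le _) hΓ.le
  · filter_upwards [ae_restrict_mem measurableSet_Ioc] with s hs
    gcongr
    exact Real.rpow_le_one hs.1.le hs.2 hn.le
  · exact (div_pos (Real.rpow_pos_of_pos hs.1 _) hΓ).ne'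
  · rw [hW 1 u hu, NNReal.coe_one, one_mul, intervalIntegral.integral_of_le zero_le_one]
    simp only [mul_div_right_comm]

lemma IsTypeI.exists_driftAndLevyMeasure (hX : IsSubordinator P X)
    (hν : HasDriftAndLevyMeasure P X d ν) (hn : 0 < n) (hW : IsTypeI P X n W) :
    ∃ (d' : ℝ) (ν' : Measure ℝ), HasDriftAndLevyMeasure P W d' ν' ∧ bgSet ν' = bgSet ν :=
  hW.2.elim (fun ⟨_, _, h⟩ => h.exists_driftAndLevyMeasure hX hν)
    fun h => h.exists_driftAndLevyMeasure hX hν hn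

lemma IsTypeII.exists_driftAndLevyMeasure (hX : IsSubordinator P X)
    (hν : HasDriftAndLevyMeasure P X d ν) (hn : 0 < n) (hW : IsTypeII P X n W) :
    ∃ (d' : ℝ) (ν' : Measure ℝ), HasDriftAndLevyMeasure P W d' ν' ∧ bgSet ν' = bgSet ν :=
  hW.2.elim (fun ⟨_, _, h⟩ => h.exists_driftAndLevyMeasure hX hν)
    fun h => h.exists_driftAndLevyMeasure hX hν hn

lemma IsTypeIII.exists_driftAndLevyMeasure (hX : IsSubordinator P X)
    (hν : HasDriftAndLevyMeasure P X d ν) (hn : 0 < n) (hW : IsTypeIII P X n W) :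
    ∃ (d' : ℝ) (ν' : Measure ℝ), HasDriftAndLevyMeasure P W d' ν' ∧ bgSet ν' = bgSet ν :=
  hW.2.elim (fun ⟨_, _, h⟩ => h.exists_driftAndLevyMeasure hX hν)
    fun h => h.exists_driftAndLevyMeasure hX hν hn

end RealDegree

/-- A constant mixture of a clock has a Lévy measure, and the Blumenthal–Getoor exponents of the
clock determine its index. -/
theorem IsSubordinator.bgIndex_constantMixture {Ω : Type*} [MeasurableSpace Ω] {P : Measure Ω}
    [IsProbabilityMeasure P] {W W' : ℝ≥0 → Ω → ℝ} (hW : IsSubordinator P W)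
    (hW' : IsIndepCopy P W W') {d : ℝ} {ν : Measure ℝ} (hν : HasDriftAndLevyMeasure P W d ν)
    (m : ℝ) {κ₁ κ₂ : ℝ} (hκ : 0 < κ₁ + κ₂) :
    (∃ ρ, HasLevyMeasure P (constantMixture m κ₁ κ₂ W W') ρ) ∧
      bgIndex P (constantMixture m κ₁ κ₂ W W') = sInf (bgSet ν) := by
  have h := hW.hasLevyMeasure_constantMixture hW' hν m κ₁ κ₂
  refine ⟨⟨_, h⟩, h.bgIndex_eq.trans ?_⟩
  rw [← hν.isClockMeasure.bgSet_scaleMeasure _ (mixtureScale_ae_le κ₁ κ₂)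
    (mixtureScale_compl_ne_zero hκ)]
  rfl

end

end RegulatedClock

/-! ### The main theorem -/

open RegulatedClock in
theorem corollary4 {Ω : Type*} [MeasurableSpace Ω] (P : Measure Ω) [IsProbabilityMeasure P]
    (X X' : ℝ≥0 → Ω → ℝ) (hX : IsSubordinator P X) (hX' : IsIndepCopy P X X')
    (d : ℝ) (ν : Measure ℝ) (hν : HasDriftAndLevyMeasure P X d ν)
    (n : ℝ) (hn : 0 < n)
    (XI XI' : ℝ≥0 → Ω → ℝ) (hI : IsTypeI P X n XI) (hI' : IsIndepCopy P XI XI')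
    (XII XII' : ℝ≥0 → Ω → ℝ) (hII : IsTypeII P X n XII) (hII' : IsIndepCopy P XII XII')
    (XIII XIII' : ℝ≥0 → Ω → ℝ) (hIII : IsTypeIII P X n XIII) (hIII' : IsIndepCopy P XIII XIII')
    (m κ₁ κ₂ : ℝ) (hκ₁ : 0 ≤ κ₁) (hκ₂ : 0 ≤ κ₂) (hκ : 0 < κ₁ + κ₂) :
    ((∃ ρ, HasLevyMeasure P (constantMixture m κ₁ κ₂ XI XI') ρ) ∧
      (∃ ρ, HasLevyMeasure P (constantMixture m κ₁ κ₂ XII XII') ρ) ∧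
      (∃ ρ, HasLevyMeasure P (constantMixture m κ₁ κ₂ XIII XIII') ρ) ∧
      (∃ ρ, HasLevyMeasure P (constantMixture m κ₁ κ₂ X X') ρ) ∧
      (∃ ρ, HasLevyMeasure P X ρ)) ∧
    bgIndex P (constantMixture m κ₁ κ₂ XI XI') = bgIndex P X ∧
    bgIndex P (constantMixture m κ₁ κ₂ XII XII') = bgIndex P X ∧
    bgIndex P (constantMixture m κ₁ κ₂ XIII XIII') = bgIndex P X ∧
    bgIndex P (constantMixture m κ₁ κ₂ X X') = bgIndex P X := by
  obtain ⟨dI, νI, hνI, hbgI⟩ := hI.exists_driftAndLevyMeasure hX hν hn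
  obtain ⟨dII, νII, hνII, hbgII⟩ := hII.exists_driftAndLevyMeasure hX hν hn
  obtain ⟨dIII, νIII, hνIII, hbgIII⟩ := hIII.exists_driftAndLevyMeasure hX hν hn
  have h0 := hX.hasLevyMeasure hν
  have hbg : bgIndex P X = sInf (bgSet ν) := h0.bgIndex_eq
  obtain ⟨hexI, hI''⟩ := hI.1.bgIndex_constantMixture hI' hνI m hκ
  obtain ⟨hexII, hII''⟩ := hII.1.bgIndex_constantMixture hII' hνII m hκ
  obtain ⟨hexIII, hIII''⟩ := hIII.1.bgIndex_constantMixture hIII' hνIII m hκ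
  obtain ⟨hexX, hX''⟩ := hX.bgIndex_constantMixture hX' hν m hκ
  refine ⟨⟨hexI, hexII, hexIII, hexX, ⟨ν, h0⟩⟩, ?_, ?_, ?_, ?_⟩
  · rw [hI'', hbgI, hbg]
  · rw [hII'', hbgII, hbg]
  · rw [hIII'', hbgIII, hbg]
  · rw [hX'', hbg]
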